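/- Let $M$ be a smooth manifold of dimension $2n+1$. A *paracontact metric structure* on $M$ consists of a $(1,1)$-tensor field $\tilde\varphi$, a vector field $\xi$, a $1$-form $\eta$ and a pseudo-Riemannian metric $\tilde g$ (all smooth) such that - $\eta(\xi)=1$ and $\tilde\varphi^2=I-\eta\otimes\xi$, and the eigendistributions of $\tilde\varphi$ for the eigenvalues $1$ and $-1$ both have dimension $n$; - $\tilde g(\tilde\varphi X,\tilde\varphi Y)=-\tilde g(X,Y)+\eta(X)\eta(Y)$ and $d\eta(X,Y)=\tilde g(X,\tilde\varphi Y)$ for all vector fields $X,Y$, where $d\eta(X,Y)=\frac12\bigl(X(\eta(Y))-Y(\eta(X))-\eta([X,Y])\bigr)$. Put $\tilde h=\frac12\mathcal L_\xi\tilde\varphi$, that is, $\tilde hX=\frac12\bigl([\xi,\tilde\varphi X]-\tilde\varphi[\xi,X]\bigr)$, and let $\tilde R_{XY}Z=\tilde\nabla_X\tilde\nabla_YZ-\tilde\nabla_Y\tilde\nabla_XZ-\tilde\nabla_{[X,Y]}Z$ be the curvature tensor of the Levi-Civita connection $\tilde\nabla$ of $\tilde g$. Then $(M,\tilde\varphi,\xi,\eta,\tilde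 g)$ is a *paracontact metric $(\tilde\kappa,\tilde\mu)$-manifold*, with real constants $\tilde\kappa,\tilde\mu$, if $$\tilde R_{XY}\xi=\tilde\kappa\bigl(\eta(Y)X-\eta(X)Y\bigr)+\tilde\mu\bigl(\eta(Y)\tilde hX-\eta(X)\tilde hY\bigr)$$ for all vector fields $X,Y$. **Theorem.** Let $(M,\tilde\varphi,\xi,\eta,\tilde g)$ be a paracontact metric $(\tilde\kappa,\tilde\mu)$-manifold with $\tilde\kappa<-1$, and let $\tilde\lambda=\sqrt{-1-\tilde\kappa}$. (1) Let $X,X',X''$ be vector fields lying in the eigendistribution of $\tilde\varphi\tilde h$ for the eigenvalue $\tilde\lambda$, and $Y,Y',Y''$ vector fields lying in the one for $-\tilde\lambda$. Then $$\begin{aligned} \tilde R_{XX'}X''={}&(\tilde\kappa-1+\tilde\mu)\bigl(\tilde g(X',X'')X-\tilde g(X,X'')X'\bigr)+\tilde\lambda\bigl(\tilde g(X',X'')\tilde\varphi X-\tilde g(X,X'')\tilde\varphi X'\bigr),\\ \tilde R_{XX'}Y={}&-\tilde\lambda\bigl(\tilde g(X',\tilde\varphi Y)X-\tilde g(X,\tilde\varphi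 Y)X'\bigr)-(1-\tilde\mu)\bigl(\tilde g(X',\tilde\varphi Y)\tilde\varphi X-\tilde g(X,\tilde\varphi Y)\tilde\varphi X'\bigr),\\ \tilde R_{XY}X'={}&-\tilde\lambda\tilde g(X',\tilde\varphi Y)X-\tilde g(X',\tilde\varphi Y)\tilde\varphi X-\tilde\lambda^2\tilde g(X,X')Y+\tilde\lambda\tilde g(X,X')\tilde\varphi Y-\tilde\mu\tilde g(X,\tilde\varphi Y)\tilde\varphi X',\\ \tilde R_{XY}Y'={}&\tilde\lambda^2\tilde g(Y,Y')X+\tilde\lambda\tilde g(Y,Y')\tilde\varphi X+\tilde\lambda\tilde g(X,\tilde\varphi Y')Y-\tilde g(X,\tilde\varphi Y')\tilde\varphi Y-\tilde\mu\tilde g(X,\tilde\varphi Y)\tilde\varphi Y',\\ \tilde R_{YY'}X={}&-\tilde\lambda\bigl(\tilde g(X,\tilde\varphi Y')Y-\tilde g(X,\tilde\varphi Y)Y'\bigr)+(1-\tilde\mu)\bigl(\tilde g(X,\tilde\varphi Y')\tilde\varphi Y-\tilde g(X,\tilde\varphi Y)\tilde\varphi Y'\bigr),\\ \tilde R_{YY'}Y''={}&(\tilde\kappa-1+\tilde\mu)\bigl(\tilde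 g(Y',Y'')Y-\tilde g(Y,Y'')Y'\bigr)-\tilde\lambda\bigl(\tilde g(Y',Y'')\tilde\varphi Y-\tilde g(Y,Y'')\tilde\varphi Y'\bigr). \end{aligned}$$ (2) For all vector fields $X,Y,Z,W$ on $M$, $$\begin{aligned} \tilde g(\tilde R_{XY}Z,W)={}&\Bigl(-1+\frac{\tilde\mu}2\Bigr)\bigl(\tilde g(Y,Z)\tilde g(X,W)-\tilde g(X,Z)\tilde g(Y,W)\bigr)\\ &+\tilde g(Y,Z)\tilde g(\tilde hX,W)-\tilde g(X,Z)\tilde g(\tilde hY,W)-\tilde g(Y,W)\tilde g(\tilde hX,Z)+\tilde g(X,W)\tilde g(\tilde hY,Z)\\ &+\frac{-1+\frac{\tilde\mu}2}{\tilde\kappa+1}\bigl(\tilde g(\tilde hY,Z)\tilde g(\tilde hX,W)-\tilde g(\tilde hX,Z)\tilde g(\tilde hY,W)\bigr)\\ &-\frac{\tilde\mu}2\bigl(\tilde g(\tilde\varphi Y,Z)\tilde g(\tilde\varphi X,W)-\tilde g(\tilde\varphi X,Z)\tilde g(\tilde\varphi Y,W)\bigr)\\ &+\frac{-\tilde\kappa-\frac{\tilde\mu}2}{\tilde\kappa+1}\bigl(\tilde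 g(\tilde\varphi\tilde hY,Z)\tilde g(\tilde\varphi\tilde hX,W)-\tilde g(\tilde\varphi\tilde hY,W)\tilde g(\tilde\varphi\tilde hX,Z)\bigr)\\ &+\tilde\mu\,\tilde g(\tilde\varphi X,Y)\tilde g(\tilde\varphi Z,W)\\ &+\eta(X)\eta(W)\Bigl(\bigl(\tilde\kappa+1-\tfrac{\tilde\mu}2\bigr)\tilde g(Y,Z)+(\tilde\mu-1)\tilde g(\tilde hY,Z)\Bigr)\\ &-\eta(X)\eta(Z)\Bigl(\bigl(\tilde\kappa+1-\tfrac{\tilde\mu}2\bigr)\tilde g(Y,W)+(\tilde\mu-1)\tilde g(\tilde hY,W)\Bigr)\\ &+\eta(Y)\eta(Z)\Bigl(\bigl(\tilde\kappa+1-\tfrac{\tilde\mu}2\bigr)\tilde g(X,W)+(\tilde\mu-1)\tilde g(\tilde hX,W)\Bigr)\\ &-\eta(Y)\eta(W)\Bigl(\bigl(\tilde\kappa+1-\tfrac{\tilde\mu}2\bigr)\tilde g(X,Z)+(\tilde\mu-1)\tilde g(\tilde hX,Z)\Bigr). \end{aligned}$$ -/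

import Mathlib

open Bundle VectorField
open scoped Manifold ContDiff
set_option linter.unusedSectionVars false

/-- A pseudo-Riemannian metric on a smooth manifold: a smooth field of symmetric nondegenerate
bilinear forms on the tangent spaces. -/
structure PseudoRiemannianMetric {E : Type*} [NormedAddCommGroup E] [NormedSpace ℝ E]
    {H : Type*} [TopologicalSpace H] (I : ModelWithCorners ℝ E H)
    (M : Type*) [TopologicalSpace M] [ChartedSpace H M] [IsManifold I ∞ M] where
  val : ∀ x : M, TangentSpace I x →L[ℝ] TangentSpace I x →L[ℝ] ℝ
  symm : ∀ (x : M) (v w : TangentSpace I x), val x v w = val x w v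
  nondegenerate : ∀ (x : M) (v : TangentSpace I x), (∀ w, val x v w = 0) → v = 0
  contMDiff : ContMDiff I (I.prod 𝓘(ℝ, E →L[ℝ] E →L[ℝ] ℝ)) ∞
    (fun x ↦ TotalSpace.mk' (E →L[ℝ] E →L[ℝ] ℝ)
      (E := fun x : M ↦ TangentSpace I x →L[ℝ] TangentSpace I x →L[ℝ] ℝ) x (val x))

noncomputable section
namespace PseudoRiemannianMetric
variable {E : Type*} [NormedAddCommGroup E] [NormedSpace ℝ E]
    {H : Type*} [TopologicalSpace H] {I : ModelWithCorners ℝ E H}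
    {M : Type*} [TopologicalSpace M] [ChartedSpace H M] [IsManifold I ∞ M]
    (g : PseudoRiemannianMetric I M)

/-- A covariant derivative is the Levi-Civita connection of `g` if it is torsion-free and
metric. Here `cov Y x v` stands for `(∇_v Y)(x)`. -/
structure IsLeviCivita [FiniteDimensional ℝ E]
    (cov : CovariantDerivative I E (TangentSpace I : M → Type _)) : Prop where
  torsion_free : ∀ {X Y : Π x : M, TangentSpace I x} {x : M},
    MDiffAt (T% X) x → MDiffAt (T% Y) x →
      cov Y x (X x) - cov X x (Y x) = mlieBracket I X Y x
  metric : ∀ {Y Z : Π x : M, TangentSpace I x} {x : M} (v : TangentSpace I x),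
    MDiffAt (T% Y) x → MDiffAt (T% Z) x →
      mvfderiv I (fun y ↦ g.val y (Y y) (Z y)) x v =
        g.val x (cov Y x v) (Z x) + g.val x (Y x) (cov Z x v)

lemma mdifferentiableAt_val {X Y : Π x : M, TangentSpace I x} {x : M}
    (hX : MDiffAt (T% X) x) (hY : MDiffAt (T% Y) x) :
    MDiffAt (fun y ↦ g.val y (X y) (Y y)) x := by
  have h : MDifferentiableAt I (I.prod 𝓘(ℝ)) (fun y ↦ TotalSpace.mk' ℝ
      (E := Bundle.Trivial M ℝ) y (g.val y (X y) (Y y))) x := by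
    apply MDifferentiableAt.clm_bundle_apply₂ (F₁ := E) (F₂ := E)
    · exact (g.contMDiff x).mdifferentiableAt (by simp)
    · exact hX
    · exact hY
  simp only [mdifferentiableAt_totalSpace] at h
  exact h.2

/-- The right-hand side of the Koszul formula for `g(∇_X Y, W)`. -/
def koszul (Y X W : Π x : M, TangentSpace I x) (x : M) : ℝ :=
  (2 : ℝ)⁻¹ * (mvfderiv I (fun y ↦ g.val y (Y y) (W y)) x (X x)
    + mvfderiv I (fun y ↦ g.val y (X y) (W y)) x (Y x)
    - mvfderiv I (fun y ↦ g.val y (X y) (Y y)) x (W x)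
    + g.val x (mlieBracket I X Y x) (W x)
    - g.val x (mlieBracket I X W x) (Y x)
    - g.val x (mlieBracket I Y W x) (X x))

lemma val_fun_smul_left (f : M → ℝ) (X Y : Π x : M, TangentSpace I x) :
    (fun y ↦ g.val y ((f • X) y) (Y y)) = f * (fun y ↦ g.val y (X y) (Y y)) := by
  ext y; simp
lemma val_fun_smul_right (f : M → ℝ) (X Y : Π x : M, TangentSpace I x) :
    (fun y ↦ g.val y (X y) ((f • Y) y)) = f * (fun y ↦ g.val y (X y) (Y y)) := by
  ext y; simp
lemma val_fun_add_left (X X' Y : Π x : M, TangentSpace I x) :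
    (fun y ↦ g.val y ((X + X') y) (Y y)) =
      (fun y ↦ g.val y (X y) (Y y)) + (fun y ↦ g.val y (X' y) (Y y)) := by
  ext y; simp
lemma val_fun_add_right (X Y Y' : Π x : M, TangentSpace I x) :
    (fun y ↦ g.val y (X y) ((Y + Y') y)) =
      (fun y ↦ g.val y (X y) (Y y)) + (fun y ↦ g.val y (X y) (Y' y)) := by
  ext y; simp

variable [CompleteSpace E]
lemma koszul_tensorial_right {Y X : Π x : M, TangentSpace I x} {x : M}
    (hY : MDiffAt (T% Y) x) (hX : MDiffAt (T% X) x) :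
    TensorialAt I E (fun W ↦ g.koszul Y X W x) x where
  smul {f W} hf hW := by
    simp only [koszul, val_fun_smul_right, mvfderiv_mul hf (g.mdifferentiableAt_val hY hW),
      mvfderiv_mul hf (g.mdifferentiableAt_val hX hW), mlieBracket_smul_right hf hW]
    simp [g.symm x (W x) (X x), g.symm x (W x) (Y x)]
    ring
  add {W W'} hW hW' := by
    simp only [koszul, val_fun_add_right, mvfderiv_add (g.mdifferentiableAt_val hY hW)
      (g.mdifferentiableAt_val hY hW'), mvfderiv_add (g.mdifferentiableAt_val hX hW)
      (g.mdifferentiableAt_val hX hW'), mlieBracket_add_right hW hW']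
    simp
    ring

lemma koszul_tensorial_left {Y W : Π x : M, TangentSpace I x} {x : M}
    (hY : MDiffAt (T% Y) x) (hW : MDiffAt (T% W) x) :
    TensorialAt I E (fun X ↦ g.koszul Y X W x) x where
  smul {f X} hf hX := by
    simp only [koszul, val_fun_smul_left, mvfderiv_mul hf (g.mdifferentiableAt_val hX hY),
      mvfderiv_mul hf (g.mdifferentiableAt_val hX hW), mlieBracket_smul_left hf hX]
    simp
    ring
  add {X X'} hX hX' := by
    simp only [koszul, val_fun_add_left, mvfderiv_add (g.mdifferentiableAt_val hX hY)
      (g.mdifferentiableAt_val hX' hY), mvfderiv_add (g.mdifferentiableAt_val hX hW)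
      (g.mdifferentiableAt_val hX' hW), mlieBracket_add_left hX hX']
    simp
    ring

lemma koszul_add {Y Y' X W : Π x : M, TangentSpace I x} {x : M}
    (hY : MDiffAt (T% Y) x) (hY' : MDiffAt (T% Y') x) (hX : MDiffAt (T% X) x)
    (hW : MDiffAt (T% W) x) :
    g.koszul (Y + Y') X W x = g.koszul Y X W x + g.koszul Y' X W x := by
  simp only [koszul, val_fun_add_left, val_fun_add_right,
      mvfderiv_add (g.mdifferentiableAt_val hX hY)
      (g.mdifferentiableAt_val hX hY'), mvfderiv_add (g.mdifferentiableAt_val hY hW)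
      (g.mdifferentiableAt_val hY' hW), mlieBracket_add_left hY hY', mlieBracket_add_right hY hY']
  simp
  ring

lemma koszul_smul {f : M → ℝ} {Y X W : Π x : M, TangentSpace I x} {x : M}
    (hf : MDiffAt f x) (hY : MDiffAt (T% Y) x) (hX : MDiffAt (T% X) x)
    (hW : MDiffAt (T% W) x) :
    g.koszul (f • Y) X W x =
      f x * g.koszul Y X W x + mvfderiv I f x (X x) * g.val x (Y x) (W x) := by
  simp only [koszul, val_fun_smul_left, val_fun_smul_right,
      mvfderiv_mul hf (g.mdifferentiableAt_val hX hY), mvfderiv_mul hf (g.mdifferentiableAt_val hY hW),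
      mlieBracket_smul_left hf hY, mlieBracket_smul_right hf hY]
  simp [g.symm x (Y x) (X x)]
  ring

variable [FiniteDimensional ℝ E]

/-- The isomorphism of the tangent space with its dual, `v ↦ g(v, ·)`. -/
def flat (x : M) : TangentSpace I x ≃ₗ[ℝ] (TangentSpace I x →L[ℝ] ℝ) :=
  haveI : FiniteDimensional ℝ (TangentSpace I x) := inferInstanceAs (FiniteDimensional ℝ E)
  haveI : T2Space (TangentSpace I x) := inferInstanceAs (T2Space E)
  LinearEquiv.ofInjectiveOfFinrankEq (g.val x).toLinearMap
    ((injective_iff_map_eq_zero _).2 fun v hv ↦ g.nondegenerate x v fun w ↦ by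
      simpa using congrArg (fun f : TangentSpace I x →L[ℝ] ℝ ↦ f w) hv)
    (by
      rw [← LinearEquiv.finrank_eq (LinearMap.toContinuousLinearMap (𝕜 := ℝ)
        (E := TangentSpace I x) (F' := ℝ))]
      exact (Subspace.dual_finrank_eq (K := ℝ) (V := TangentSpace I x)).symm)

lemma flat_apply (x : M) (v w : TangentSpace I x) : g.flat x v w = g.val x v w := rfl

open Classical in
/-- The covariant derivative determined by the Koszul formula. -/
def koszulCov (Y : Π x : M, TangentSpace I x) (x : M) : TangentSpace I x →L[ℝ] TangentSpace I x :=
  haveI : FiniteDimensional ℝ (TangentSpace I x) := inferInstanceAs (FiniteDimensional ℝ E)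
  haveI : T2Space (TangentSpace I x) := inferInstanceAs (T2Space E)
  if hY : MDiffAt (T% Y) x then
    LinearMap.toContinuousLinearMap ((g.flat x).symm.toLinearMap ∘ₗ
      (TensorialAt.mkHom₂ (fun X W ↦ g.koszul Y X W x) x
        (fun _ hW ↦ g.koszul_tensorial_left hY hW)
        (fun _ hX ↦ g.koszul_tensorial_right hY hX)).toLinearMap)
  else 0

lemma val_koszulCov {Y X W : Π x : M, TangentSpace I x} {x : M}
    (hY : MDiffAt (T% Y) x) (hX : MDiffAt (T% X) x) (hW : MDiffAt (T% W) x) :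
    g.val x (g.koszulCov Y x (X x)) (W x) = g.koszul Y X W x := by
  rw [← flat_apply]
  simp only [koszulCov, hY, dif_pos]
  simp only [LinearMap.coe_toContinuousLinearMap', LinearMap.comp_apply,
    LinearEquiv.coe_coe, LinearEquiv.apply_symm_apply]
  exact TensorialAt.mkHom₂_apply _ _ hX hW

lemma eq_of_val_eq {x : M} {u v : TangentSpace I x}
    (h : ∀ W : Π x : M, TangentSpace I x, MDiffAt (T% W) x → g.val x u (W x) = g.val x v (W x)) :
    u = v := by
  rw [← sub_eq_zero]
  refine g.nondegenerate x _ fun w ↦ ?_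
  have := h (FiberBundle.extend E w) (FiberBundle.mdifferentiableAt_extend ..)
  simpa [sub_eq_zero] using this

lemma clm_ext {x : M} {A B : TangentSpace I x →L[ℝ] TangentSpace I x}
    (h : ∀ X : Π x : M, TangentSpace I x, MDiffAt (T% X) x → A (X x) = B (X x)) : A = B := by
  ext v
  simpa using h (FiberBundle.extend E v) (FiberBundle.mdifferentiableAt_extend ..)

/-- Existence of the Levi-Civita connection. -/
theorem exists_isLeviCivita : ∃ cov : CovariantDerivative I E (TangentSpace I : M → Type _),
    g.IsLeviCivita cov := by
  refine ⟨⟨g.koszulCov, ?_, ?_⟩, ?_, ?_⟩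
  · intro Y Y' x hY hY' _
    refine clm_ext fun X hX ↦ g.eq_of_val_eq fun W hW ↦ ?_
    rw [g.val_koszulCov (mdifferentiableAt_add_section hY hY') hX hW, g.koszul_add hY hY' hX hW]
    simp [g.val_koszulCov, hY, hY', hX, hW]
  · intro Y f x hY hf _
    refine clm_ext fun X hX ↦ g.eq_of_val_eq fun W hW ↦ ?_
    rw [g.val_koszulCov (hf.smul_section hY) hX hW, g.koszul_smul hf hY hX hW]
    simp [g.val_koszulCov, hY, hX, hW]
  · intro X Y x hX hY
    refine g.eq_of_val_eq fun W hW ↦ ?_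
    simp only [map_sub, _root_.sub_apply, g.val_koszulCov hY hX hW,
      g.val_koszulCov hX hY hW, koszul, mlieBracket_swap_apply (V := Y) (W := X)]
    simp [g.symm _ (Y _) (X _)]
    ring
  · intro Y Z x v hY hZ
    have key (X : Π x : M, TangentSpace I x) (hX : MDiffAt (T% X) x) :
        mvfderiv I (fun y ↦ g.val y (Y y) (Z y)) x (X x) =
        g.val x (g.koszulCov Y x (X x)) (Z x) + g.val x (Y x) (g.koszulCov Z x (X x)) := by
      rw [g.symm x (Y x), g.val_koszulCov hY hX hZ, g.val_koszulCov hZ hX hY]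
      simp only [koszul, mlieBracket_swap_apply (V := Z) (W := Y), g.symm _ (Z _) (Y _)]
      simp
      ring
    simpa using key (FiberBundle.extend E v) (FiberBundle.mdifferentiableAt_extend ..)

/-- The Levi-Civita connection of `g`. It exists by the preceding theorem, and on differentiable
fields it is unique. -/
def leviCivita : CovariantDerivative I E (TangentSpace I : M → Type _) :=
  Classical.choose g.exists_isLeviCivita

lemma isLeviCivita_leviCivita : g.IsLeviCivita g.leviCivita :=
  Classical.choose_spec g.exists_isLeviCivita

/-- Uniqueness of the Levi-Civita connection. -/
lemma IsLeviCivita.unique {cov : CovariantDerivative I E (TangentSpace I : M → Type _)}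
    (h : g.IsLeviCivita cov) {Y : Π x : M, TangentSpace I x} {x : M} (hY : MDiffAt (T% Y) x) :
    cov Y x = g.leviCivita Y x := by
  suffices H : ∀ c : CovariantDerivative I E (TangentSpace I : M → Type _), g.IsLeviCivita c →
      c Y x = g.koszulCov Y x from (H cov h).trans (H _ g.isLeviCivita_leviCivita).symm
  intro c hc
  refine clm_ext fun X hX ↦ g.eq_of_val_eq fun W hW ↦ ?_
  rw [g.val_koszulCov hY hX hW, koszul]
  have e1 := hc.metric (X x) hY hW
  have e2 := hc.metric (Y x) hX hW
  have e3 := hc.metric (W x) hX hY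
  rw [e1, e2, e3, ← hc.torsion_free hX hY, ← hc.torsion_free hX hW, ← hc.torsion_free hY hW]
  simp only [map_sub, _root_.sub_apply]
  rw [g.symm x (Y x) (c W x (X x)), g.symm x (X x) (c W x (Y x)), g.symm x (X x) (c Y x (W x))]
  ring

/-- The curvature tensor `R_{XY} Z = ∇_X ∇_Y Z - ∇_Y ∇_X Z - ∇_{[X,Y]} Z` of the Levi-Civita
connection of `g`, evaluated at `x`. -/
def curvature (X Y Z : Π x : M, TangentSpace I x) (x : M) : TangentSpace I x :=
  g.leviCivita (fun y ↦ g.leviCivita Z y (Y y)) x (X x)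
    - g.leviCivita (fun y ↦ g.leviCivita Z y (X y)) x (Y x)
    - g.leviCivita Z x (mlieBracket I X Y x)

end PseudoRiemannianMetric

section Paracontact

variable {E : Type*} [NormedAddCommGroup E] [NormedSpace ℝ E]
    {H : Type*} [TopologicalSpace H] {I : ModelWithCorners ℝ E H}
    {M : Type*} [TopologicalSpace M] [ChartedSpace H M]

/-- The vector field `X`, which may be defined only near `x`, is smooth at `x`. -/
def SmoothFieldAt [IsManifold I ∞ M] (X : Π x : M, TangentSpace I x) (x : M) : Prop :=
  CMDiffAt ∞ (T% X) x

/-- The exterior derivative of a 1-form, evaluated on two vector fields at `x`, with the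
convention `2 dη(X,Y) = X(η(Y)) - Y(η(X)) - η([X,Y])` of contact metric geometry. -/
def oneFormDeriv (η : Π x : M, TangentSpace I x →L[ℝ] ℝ) (X Y : Π x : M, TangentSpace I x)
    (x : M) : ℝ :=
  (1 / 2 : ℝ) * (mvfderiv I (fun y ↦ η y (Y y)) x (X x)
    - mvfderiv I (fun y ↦ η y (X y)) x (Y x) - η x (mlieBracket I X Y x))

/-- The vector field `h X`, where `h = ½ L_ξ φ`, that is, `h X = ½ ([ξ, φ X] - φ [ξ, X])`. -/
def paraH (φ : Π x : M, TangentSpace I x →L[ℝ] TangentSpace I x) (ξ X : Π x : M, TangentSpace I x)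
    (x : M) : TangentSpace I x :=
  (1 / 2 : ℝ) • (mlieBracket I ξ (fun y ↦ φ y (X y)) x - φ x (mlieBracket I ξ X x))

variable [IsManifold I ∞ M]

/-- An almost paracontact structure on a manifold of dimension `2n + 1`: smooth tensor fields
`φ`, `ξ`, `η` of types (1,1), (1,0), (0,1) with `η(ξ) = 1` and `φ² = id - η ⊗ ξ` such that the
eigenspaces of `φ` for the eigenvalues `1` and `-1` both have dimension `n`. -/
structure IsAlmostParacontact (n : ℕ) (φ : Π x : M, TangentSpace I x →L[ℝ] TangentSpace I x)
    (ξ : Π x : M, TangentSpace I x) (η : Π x : M, TangentSpace I x →L[ℝ] ℝ) : Prop where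
  finrank_eq : Module.finrank ℝ E = 2 * n + 1
  smooth_phi : ContMDiff I (I.prod 𝓘(ℝ, E →L[ℝ] E)) ∞
    (fun x ↦ TotalSpace.mk' (E →L[ℝ] E)
      (E := fun x : M ↦ TangentSpace I x →L[ℝ] TangentSpace I x) x (φ x))
  smooth_xi : CMDiff ∞ (T% ξ)
  smooth_eta : ContMDiff I (I.prod 𝓘(ℝ, E →L[ℝ] ℝ)) ∞
    (fun x ↦ TotalSpace.mk' (E →L[ℝ] ℝ) (E := fun x : M ↦ TangentSpace I x →L[ℝ] ℝ) x (η x))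
  eta_xi : ∀ x, η x (ξ x) = 1
  phi_sq : ∀ (x : M) (v : TangentSpace I x), φ x (φ x v) = v - η x v • ξ x
  finrank_eigenspace_one : ∀ x,
    Module.finrank ℝ (Module.End.eigenspace (φ x).toLinearMap (1 : ℝ)) = n
  finrank_eigenspace_neg_one : ∀ x,
    Module.finrank ℝ (Module.End.eigenspace (φ x).toLinearMap (-1 : ℝ)) = n

/-- A paracontact metric structure on a manifold of dimension `2n + 1`: an almost paracontact
structure with a pseudo-Riemannian metric such that `g(φ X, φ Y) = -g(X,Y) + η(X) η(Y)` and
`dη(X,Y) = g(X, φ Y)`. Vector fields are only required to be smooth at the point under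
consideration, so that locally defined fields are included. -/
structure IsParacontactMetric (n : ℕ) (φ : Π x : M, TangentSpace I x →L[ℝ] TangentSpace I x)
    (ξ : Π x : M, TangentSpace I x) (η : Π x : M, TangentSpace I x →L[ℝ] ℝ)
    (g : PseudoRiemannianMetric I M) : Prop extends IsAlmostParacontact n φ ξ η where
  metric_phi : ∀ (x : M) (v w : TangentSpace I x),
    g.val x (φ x v) (φ x w) = - g.val x v w + η x v * η x w
  deriv_eta : ∀ (X Y : Π x : M, TangentSpace I x) (x : M),
    SmoothFieldAt X x → SmoothFieldAt Y x →
      oneFormDeriv η X Y x = g.val x (X x) (φ x (Y x))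

/-- A paracontact metric `(κ, μ)`-manifold of dimension `2n + 1`: a paracontact metric manifold
with `R_{XY} ξ = κ (η(Y) X - η(X) Y) + μ (η(Y) h X - η(X) h Y)`. -/
structure IsParacontactKappaMu [FiniteDimensional ℝ E] (n : ℕ)
    (φ : Π x : M, TangentSpace I x →L[ℝ] TangentSpace I x)
    (ξ : Π x : M, TangentSpace I x) (η : Π x : M, TangentSpace I x →L[ℝ] ℝ)
    (g : PseudoRiemannianMetric I M) (κ μ : ℝ) : Prop extends IsParacontactMetric n φ ξ η g where
  nullity : ∀ (X Y : Π x : M, TangentSpace I x) (x : M),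
    SmoothFieldAt X x → SmoothFieldAt Y x →
      g.curvature X Y ξ x = κ • (η x (Y x) • X x - η x (X x) • Y x)
        + μ • (η x (Y x) • paraH φ ξ X x - η x (X x) • paraH φ ξ Y x)

end Paracontact

end

/-! Write P = φh and l² = -1-κ > 0. The skew part of ∇ξ is dη, and closedness of dη identifies the
rest: ∇_Xξ = PX - φX, where P is symmetric, kills ξ and anticommutes with φ; moreover ∇_ξφ = 0. The
nullity condition on the pair (X, ξ) is a Riccati equation for P along ξ, whose part commuting with
φ says P² = -(1+κ)φ² (`phiH_sq`). Hence ker η splits into the eigenspaces D(l) and D(-l) of P, and φ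
interchanges them.

The main point is that ∇φ and ∇P have no purely horizontal component (`g_cov_phi_horizontal`,
`g_cov_phiH_horizontal`). For horizontal Y, Z the nullity condition reads R_{YZ}ξ = 0, a Codazzi
equation relating ∇P to ∇φ. Since P² is constant on ker η, ∇P vanishes between eigenvectors with the
same eigenvalue. Symmetry arguments on the eigenspaces remove the other components, so ∇φ and ∇P are
explicit in ∇ξ, φ, P and μ (`cov_phi_eq`, `cov_phiH_eq`).

The Ricci identity then gives the commutators of R_{XY} with φ and with P on ker η (`g_R_phi`,
`g_R_phiH`). The claimed expression for R has the same commutators, the same value on ξ and the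
symmetries of a curvature tensor. The difference is a curvature-like tensor that kills ξ and
commutes with φ and P, and such a tensor is zero (`curvature_form_eq_zero`): commuting with P kills
it on a last pair from different eigenspaces, hence also on such a first pair; the cyclic identity
and φ then kill the remaining components. This is part (2). Part (1) is its restriction to
eigenvectors, where hX = ±l φX, D(l) is orthogonal to D(-l), and g(X, φX') = 0 for X, X' in the same
eigenspace.

The computation takes place in a module over an algebra of functions, where tensor identities are
purely algebraic. The model is realized by the smooth fields on the base set of a trivialization
(`exists_model`), and the result is evaluated at a point. -/

/-- An algebraic model of the vector fields on a pseudo-Riemannian manifold: a module `V` over an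
algebra `C` of functions, acting on `C` by derivations, with a nondegenerate symmetric form and its
Levi-Civita connection. The Lie bracket is `∇_X Y - ∇_Y X`. -/
structure LeviCivitaModule (C V : Type*) [CommRing C] [Algebra ℝ C] [AddCommGroup V]
    [Module C V] where
  D : V → Derivation ℝ C C
  g : V →ₗ[C] V →ₗ[C] C
  nabla : V →ₗ[C] V →+ V
  g_symm : ∀ X Y, g X Y = g Y X
  nondegenerate : ∀ X, (∀ Y, g X Y = 0) → X = 0
  nabla_smul : ∀ (f : C) (X Y : V), nabla X (f • Y) = f • nabla X Y + D X f • Y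
  D_g : ∀ X Y Z, D X (g Y Z) = g (nabla X Y) Z + g Y (nabla X Z)
  D_bracket : ∀ X Y f, D X (D Y f) - D Y (D X f) = D (nabla X Y - nabla Y X) f
  bianchi : ∀ X Y Z,
    (nabla X (nabla Y Z) - nabla Y (nabla X Z) - nabla (nabla X Y - nabla Y X) Z)
    + (nabla Y (nabla Z X) - nabla Z (nabla Y X) - nabla (nabla Y Z - nabla Z Y) X)
    + (nabla Z (nabla X Y) - nabla X (nabla Z Y) - nabla (nabla Z X - nabla X Z) Y) = 0

/-! ### Curvature symmetries in the algebraic model. -/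

namespace LeviCivitaModule

variable {C V : Type*} [CommRing C] [Algebra ℝ C] [AddCommGroup V] [Module C V]
  (L : LeviCivitaModule C V)

/-- The Lie bracket. -/
def br (X Y : V) : V := L.nabla X Y - L.nabla Y X

/-- The curvature tensor. -/
def R (X Y Z : V) : V :=
  L.nabla X (L.nabla Y Z) - L.nabla Y (L.nabla X Z) - L.nabla (L.br X Y) Z

/-- The covariant derivative `(∇_X T) Y` of a field of endomorphisms. -/
def cov (T : V →ₗ[C] V) (X Y : V) : V := L.nabla X (T Y) - T (L.nabla X Y)

lemma nabla_map (T : V →ₗ[C] V) (X Y : V) : L.nabla X (T Y) = L.cov T X Y + T (L.nabla X Y) := by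
  simp [cov]

lemma ext_g {X Y : V} (h : ∀ Z, L.g X Z = L.g Y Z) : X = Y := by
  rw [← sub_eq_zero]
  exact L.nondegenerate _ fun Z ↦ by simp [h]

lemma half_mul_two : algebraMap ℝ C (1 / 2) * 2 = 1 := by
  rw [← map_ofNat (algebraMap ℝ C) 2, ← map_mul]; norm_num

lemma eq_zero_of_two_mul {a : C} (h : 2 * a = 0) : a = 0 := by
  linear_combination algebraMap ℝ C (1 / 2) * h - a * half_mul_two (C := C)

lemma cov_add_left (T : V →ₗ[C] V) (X X' Y : V) :
    L.cov T (X + X') Y = L.cov T X Y + L.cov T X' Y := by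
  simp [cov]; abel

lemma cov_smul_left (T : V →ₗ[C] V) (f : C) (X Y : V) :
    L.cov T (f • X) Y = f • L.cov T X Y := by
  simp [cov, smul_sub]

lemma cov_add_right (T : V →ₗ[C] V) (X Y Y' : V) :
    L.cov T X (Y + Y') = L.cov T X Y + L.cov T X Y' := by
  simp [cov]; abel

lemma cov_smul_right (T : V →ₗ[C] V) (f : C) (X Y : V) :
    L.cov T X (f • Y) = f • L.cov T X Y := by
  simp [cov, smul_sub, nabla_smul]

lemma R_swap (X Y Z : V) : L.R Y X Z = - L.R X Y Z := by
  simp [R, br]; abel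

/-- The operator D_X D_Y - D_Y D_X - D_[X,Y] annihilates the function g(Z, W); metricity expands
this into the claim. -/
lemma g_R_swap_right (X Y Z W : V) : L.g (L.R X Y Z) W = - L.g (L.R X Y W) Z := by
  have h := L.D_bracket X Y (L.g Z W)
  simp only [D_g, map_add] at h
  simp only [R, br, map_sub, LinearMap.sub_apply, L.g_symm _ Z] at h ⊢
  linear_combination h

lemma R_cyclic (X Y Z : V) : L.R X Y Z + L.R Y Z X + L.R Z X Y = 0 := L.bianchi X Y Z

lemma g_R_pair (X Y Z W : V) : L.g (L.R X Y Z) W = L.g (L.R Z W X) Y := by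
  have b (X Y Z W : V) :
      L.g (L.R X Y Z) W + L.g (L.R Y Z X) W + L.g (L.R Z X Y) W = 0 := by
    simpa using congrArg (fun v ↦ L.g v W) (L.R_cyclic X Y Z)
  have s (X Y Z W : V) : L.g (L.R Y X Z) W = - L.g (L.R X Y Z) W := by simp [L.R_swap X Y]
  rw [← sub_eq_zero]
  apply eq_zero_of_two_mul
  -- Four cyclic identities with signs +, +, -, -: modulo the skew-symmetries everything cancels
  -- except twice the desired difference.
  linear_combination b X Y Z W + b Y Z W X - b Z W X Y - b W X Y Z
    - L.g_R_swap_right Y Z W X - L.g_R_swap_right Z W Y X + s Z X W Y - L.g_R_swap_right Z X W Y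
    + L.g_R_swap_right W X Y Z + L.g_R_swap_right X Y W Z + s W Y X Z - L.g_R_swap_right W Y X Z

end LeviCivitaModule

/-! ### First-order structure: ∇ξ, h and φh. -/

namespace LeviCivitaModule

variable {C V : Type*} [CommRing C] [Algebra ℝ C] [AddCommGroup V] [Module C V]
  (L : LeviCivitaModule C V)

/-- Paracontact metric `(κ, μ)`-structures in the algebraic model. -/
structure IsKappaMu (φ : V →ₗ[C] V) (ξ : V) (η : V →ₗ[C] C) (h : V → V) (κ μ : ℝ) : Prop where
  eta_xi : η ξ = 1
  phi_sq : ∀ X, φ (φ X) = X - η X • ξ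
  metric_phi : ∀ X Y, L.g (φ X) (φ Y) = - L.g X Y + η X * η Y
  deriv_eta : ∀ X Y, L.D X (η Y) - L.D Y (η X) - η (L.br X Y) = 2 * L.g X (φ Y)
  two_h : ∀ X, (2 : C) • h X = L.br ξ (φ X) - φ (L.br ξ X)
  nullity : ∀ X Y, L.R X Y ξ = algebraMap ℝ C κ • (η Y • X - η X • Y)
    + algebraMap ℝ C μ • (η Y • h X - η X • h Y)

/-- The endomorphism `X ↦ ∇_X ξ`. -/
def shape (ξ : V) : V →ₗ[C] V where
  toFun X := L.nabla X ξ
  map_add' := by simp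
  map_smul' := by simp

lemma shape_apply (ξ X : V) : L.shape ξ X = L.nabla X ξ := rfl

namespace IsKappaMu

variable {L} {φ : V →ₗ[C] V} {ξ : V} {η : V →ₗ[C] C} {h : V → V} {κ μ : ℝ}
  (H : L.IsKappaMu φ ξ η h κ μ)

include H

lemma skew (X Y : V) : L.g X (φ Y) = - L.g Y (φ X) := by
  have h1 := H.deriv_eta X Y
  have h2 := H.deriv_eta Y X
  rw [← sub_eq_zero]
  apply eq_zero_of_two_mul
  simp only [br, map_sub] at h1 h2
  linear_combination -h1 - h2

lemma g_phi_left (X Y : V) : L.g (φ X) Y = - L.g X (φ Y) := by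
  rw [L.g_symm, H.skew]

lemma g_phi_phi_xi (X : V) : L.g (φ X) (φ ξ) = 0 := by
  rw [H.g_phi_left, H.phi_sq, H.eta_xi]; simp

lemma g_xi (X : V) : L.g X ξ = η X := by
  have h1 (X) := H.metric_phi X ξ
  simp only [H.g_phi_phi_xi, H.eta_xi] at h1
  linear_combination h1 X

lemma g_xi_left (X : V) : L.g ξ X = η X := by rw [L.g_symm, H.g_xi]

/-- The vector φξ is orthogonal to the image of φ, which contains every X - η(X)ξ, and it is
orthogonal to ξ because φ is skew. Nondegeneracy concludes. -/
lemma phi_xi : φ ξ = 0 := by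
  apply L.nondegenerate
  intro X
  have h1 := H.g_phi_phi_xi (φ X)
  have h2 : L.g ξ (φ ξ) = 0 := by
    apply eq_zero_of_two_mul
    linear_combination H.skew ξ ξ
  rw [H.phi_sq] at h1
  simp only [map_sub, map_smul, LinearMap.sub_apply, LinearMap.smul_apply, h2] at h1
  simpa [L.g_symm _ X] using h1

lemma eta_phi (X : V) : η (φ X) = 0 := by
  rw [← H.g_xi, H.g_phi_left, H.phi_xi]; simp

lemma eta_nabla_xi (X : V) : η (L.nabla X ξ) = 0 := by
  apply eq_zero_of_two_mul
  have := L.D_g X ξ ξ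
  rw [H.g_xi, H.eta_xi, Derivation.map_one_eq_zero, H.g_xi_left, H.g_xi] at this
  linear_combination -this

lemma D_eta (X Y : V) : L.D X (η Y) = η (L.nabla X Y) + L.g Y (L.nabla X ξ) := by
  rw [← H.g_xi, L.D_g, H.g_xi]

/-- The connection is torsion-free, so dη is the skew part of ∇ξ. -/
lemma g_nabla_xi (X Y : V) :
    L.g (L.nabla X ξ) Y - L.g (L.nabla Y ξ) X = 2 * L.g X (φ Y) := by
  rw [← H.deriv_eta, H.D_eta, H.D_eta, br, map_sub, L.g_symm _ Y, L.g_symm _ X]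
  ring

lemma nabla_xi_xi : L.nabla ξ ξ = 0 := by
  apply L.nondegenerate
  intro X
  have := H.g_nabla_xi ξ X
  rw [H.g_xi_left, H.g_xi, H.eta_phi, H.eta_nabla_xi] at this
  linear_combination this

/-- The covariant derivative of `φ` is skew-symmetric. -/
lemma g_cov_phi (X Y Z : V) : L.g Y (L.cov φ X Z) = - L.g Z (L.cov φ X Y) := by
  have h1 := L.D_g X Y (φ Z)
  have h2 := L.D_g X Z (φ Y)
  have h3 : L.D X (L.g Y (φ Z)) + L.D X (L.g Z (φ Y)) = 0 := by
    rw [H.skew Y Z, map_neg]; ring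
  simp only [L.nabla_map φ, map_add] at h1 h2
  linear_combination h3 - h1 - h2 - H.skew (L.nabla X Y) Z - H.skew (L.nabla X Z) Y

omit H in
lemma R_xi (X Y : V) :
    L.R X Y ξ = L.cov (L.shape ξ) X Y - L.cov (L.shape ξ) Y X := by
  simp only [R, br, cov, shape_apply, map_sub, AddMonoidHom.sub_apply]
  abel

/-- The covariant derivative of `g_nabla_xi`. -/
lemma g_cov_shape (Z X Y : V) :
    L.g (L.cov (L.shape ξ) Z X) Y - L.g (L.cov (L.shape ξ) Z Y) X = 2 * L.g X (L.cov φ Z Y) := by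
  have h0 : L.D Z (L.g (L.shape ξ X) Y - L.g (L.shape ξ Y) X) = 2 * L.D Z (L.g X (φ Y)) := by
    simp only [shape_apply]
    rw [H.g_nabla_xi]
    simp [two_mul]
  simp only [map_sub, D_g, L.nabla_map (L.shape ξ), L.nabla_map φ, map_add,
    LinearMap.add_apply] at h0
  have h1 := H.g_nabla_xi (L.nabla Z X) Y
  have h2 := H.g_nabla_xi X (L.nabla Z Y)
  simp only [shape_apply] at h0 ⊢
  linear_combination h0 - h1 - h2

/-- The fundamental 2-form is closed. -/
lemma cov_phi_cyclic (X Y Z : V) :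
    L.g Y (L.cov φ X Z) + L.g Z (L.cov φ Y X) + L.g X (L.cov φ Z Y) = 0 := by
  apply eq_zero_of_two_mul
  -- The form g(X, φY) is dη, so the claim is d² = 0. Here it comes from the first Bianchi identity
  -- paired with ξ: moving ξ into the third slot leaves the terms R_{XY}ξ, which are skewed second
  -- derivatives of ξ.
  have hb := congrArg (fun v ↦ L.g v ξ) (L.R_cyclic X Y Z)
  simp only [map_add, LinearMap.add_apply, map_zero, LinearMap.zero_apply] at hb
  rw [L.g_R_swap_right, L.g_R_swap_right Y, L.g_R_swap_right Z] at hb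
  simp only [R_xi, map_sub, LinearMap.sub_apply] at hb
  linear_combination - H.g_cov_shape X Y Z - H.g_cov_shape Y Z X - H.g_cov_shape Z X Y - hb

lemma cov_phi_xi (X : V) : L.cov φ X ξ = - φ (L.nabla X ξ) := by
  simp [cov, H.phi_xi]

lemma g_phi_phi (X Y : V) : L.g X (φ (φ Y)) = L.g Y (φ (φ X)) := by
  have := H.g_phi_left X (φ Y)
  rw [H.skew] at this
  linear_combination this

/-- Twice h is L_ξφ = ∇_ξφ - ∇_{φ·}ξ + φ∇_·ξ. Closedness of the fundamental form expresses ∇_ξφ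
through ∇ξ, so ∇_ξφ = 0 need not be known beforehand. -/
lemma g_h (X Y : V) : L.g X (h Y) = L.g (φ (L.nabla X ξ) + φ (φ X)) Y := by
  rw [← sub_eq_zero]
  apply eq_zero_of_two_mul
  have h1 : 2 * L.g X (h Y) = L.g X (L.cov φ ξ Y) - L.g X (L.nabla (φ Y) ξ)
      + L.g X (φ (L.nabla Y ξ)) := by
    have := congrArg (L.g X) (H.two_h Y)
    simp only [map_smul, smul_eq_mul, br, L.nabla_map φ, map_sub, map_add] at this
    linear_combination this
  have h2 := H.cov_phi_cyclic ξ X Y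
  rw [H.g_cov_phi Y ξ X] at h2
  simp only [H.cov_phi_xi, map_neg] at h2
  have h3 := H.g_nabla_xi (φ Y) X
  simp only [map_add, LinearMap.add_apply, H.g_phi_left, L.g_symm _ X] at h1 h2 h3 ⊢
  have h4 := H.skew Y (L.nabla X ξ)
  have h5 := H.g_phi_phi X Y
  linear_combination h1 + h2 - h3 + h4 - 2 * h5

lemma h_eq_neg (Y : V) : h Y = - (L.nabla (φ Y) ξ + φ (φ Y)) := by
  refine ext_g L fun X ↦ ?_
  rw [L.g_symm, H.g_h]
  have h3 := H.g_nabla_xi (φ Y) X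
  simp only [map_add, map_neg, LinearMap.neg_apply, LinearMap.add_apply, H.g_phi_left, L.g_symm _ X] at h3 ⊢
  linear_combination h3 + H.g_phi_phi X Y

/-- This is L_ξ applied to φ² = id - η ⊗ ξ; the right-hand side is invariant because ∇_ξξ = 0 makes
L_ξη vanish. -/
lemma h_phi (X : V) : h (φ X) = - φ (h X) := by
  have h1 := H.two_h X
  have h2 := H.two_h (φ X)
  have h3 := congrArg φ h1
  have h4 : (2 : C) • (h (φ X) + φ (h X)) = 0 := by
    rw [smul_add, h2, ← map_smul, h1]
    simp only [br, map_sub, H.phi_sq, map_smul, L.nabla_smul, H.D_eta,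
      AddMonoidHom.sub_apply, H.nabla_xi_xi, H.eta_nabla_xi, AddMonoidHom.smul_apply, map_zero]
    module
  have h5 := congrArg (fun v ↦ algebraMap ℝ C (1 / 2) • v) h4
  simp only [smul_smul, half_mul_two, one_smul, smul_zero] at h5
  exact eq_neg_of_add_eq_zero_left h5

end IsKappaMu

/-- The endomorphism `X ↦ ∇_X ξ + φ X`, which is `φ h` on a paracontact metric manifold. -/
def phiH (φ : V →ₗ[C] V) (ξ : V) : V →ₗ[C] V := L.shape ξ + φ

namespace IsKappaMu

variable {L} {φ : V →ₗ[C] V} {ξ : V} {η : V →ₗ[C] C} {h : V → V} {κ μ : ℝ}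
  (H : L.IsKappaMu φ ξ η h κ μ)

omit H in
lemma nabla_xi (X : V) : L.nabla X ξ = L.phiH φ ξ X - φ X := by
  simp [phiH, shape_apply]

include H

lemma phiH_xi : L.phiH φ ξ ξ = 0 := by
  simp [phiH, shape_apply, H.nabla_xi_xi, H.phi_xi]

lemma eta_phiH (X : V) : η (L.phiH φ ξ X) = 0 := by
  simp [phiH, shape_apply, H.eta_nabla_xi, H.eta_phi]

/-- Combines h = -Pφ, with P = `phiH`, and hφ = -φh. -/
lemma phiH_phi (X : V) : L.phiH φ ξ (φ X) = - φ (L.phiH φ ξ X) := by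
  have h1 (Y) : h Y = - L.phiH φ ξ (φ Y) := H.h_eq_neg Y
  have h2 := congrArg φ (H.h_phi X)
  rw [h1, h1, H.phi_sq] at h2
  simp only [map_sub, map_smul, H.phiH_xi, map_neg, H.phi_sq, H.eta_phiH] at h2
  simp at h2
  rw [h2]

lemma h_eq (X : V) : h X = φ (L.phiH φ ξ X) := by
  rw [← neg_neg (φ _), ← H.phiH_phi]
  exact H.h_eq_neg X

lemma phiH_symm (X Y : V) : L.g (L.phiH φ ξ X) Y = L.g X (L.phiH φ ξ Y) := by
  have := H.g_nabla_xi X Y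
  simp only [nabla_xi (φ := φ), map_sub, LinearMap.sub_apply, H.g_phi_left, L.g_symm _ X] at this
  have h2 := H.skew X Y
  linear_combination this + h2

/-- With h = φP and ∇ξ = P - φ, the terms of 2h = L_ξφ other than ∇_ξφ already add up to 2φP. -/
lemma cov_xi_eq_zero (X : V) : L.cov φ ξ X = 0 := by
  have h1 := H.two_h X
  simp only [br, L.nabla_map φ, map_sub, H.h_eq, nabla_xi (φ := φ), H.phiH_phi] at h1
  linear_combination (norm := module) -h1

end IsKappaMu
end LeviCivitaModule

/-! ### The covariant derivatives of φ and φh. -/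

namespace LeviCivitaModule

variable {C V : Type*} [CommRing C] [Algebra ℝ C] [AddCommGroup V] [Module C V]
  (L : LeviCivitaModule C V)

lemma cov_shape (φ : V →ₗ[C] V) (ξ X Y : V) :
    L.cov (L.shape ξ) X Y = L.cov (L.phiH φ ξ) X Y - L.cov φ X Y := by
  simp only [cov, phiH, LinearMap.add_apply, map_add]
  abel

lemma D_algebraMap_mul (X : V) (r : ℝ) (f : C) :
    L.D X (algebraMap ℝ C r * f) = algebraMap ℝ C r * L.D X f := by
  simp

/-- The Ricci identity. It converts formulas for ∇φ and ∇P into commutators of the curvature with φ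
and P. -/
lemma ricci (T : V →ₗ[C] V) (X Y Z : V) :
    L.R X Y (T Z) - T (L.R X Y Z) =
      (L.nabla X (L.cov T Y Z) - L.cov T (L.nabla X Y) Z - L.cov T Y (L.nabla X Z))
      - (L.nabla Y (L.cov T X Z) - L.cov T (L.nabla Y X) Z - L.cov T X (L.nabla Y Z)) := by
  simp only [R, br, cov, map_sub, AddMonoidHom.sub_apply]
  abel

namespace IsKappaMu

variable {L} {φ : V →ₗ[C] V} {ξ : V} {η : V →ₗ[C] C} {h : V → V} {κ μ : ℝ}
  (H : L.IsKappaMu φ ξ η h κ μ)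

include H

lemma cov_phiH_phi (X Y : V) :
    L.cov (L.phiH φ ξ) X (φ Y) = - L.phiH φ ξ (L.cov φ X Y) - L.cov φ X (L.phiH φ ξ Y)
      - φ (L.cov (L.phiH φ ξ) X Y) := by
  simp only [cov, H.phiH_phi, map_sub, map_neg]
  abel

lemma cov_phi_phi (X Z : V) :
    L.cov φ X (φ Z) + φ (L.cov φ X Z) = - L.g Z (L.nabla X ξ) • ξ - η Z • L.nabla X ξ := by
  simp only [cov, H.phi_sq, map_sub, L.nabla_smul, H.D_eta]
  module

lemma phiH_symm_cov (X Y Z : V) :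
    L.g Y (L.cov (L.phiH φ ξ) X Z) = L.g Z (L.cov (L.phiH φ ξ) X Y) := by
  have h1 := L.D_g X Y (L.phiH φ ξ Z)
  have h2 := L.D_g X Z (L.phiH φ ξ Y)
  have h3 : L.D X (L.g Y (L.phiH φ ξ Z)) = L.D X (L.g Z (L.phiH φ ξ Y)) := by
    rw [← H.phiH_symm, L.g_symm]
  simp only [L.nabla_map (L.phiH φ ξ), map_add] at h1 h2
  have h4 := H.phiH_symm (L.nabla X Y) Z
  have h5 := H.phiH_symm (L.nabla X Z) Y
  rw [L.g_symm] at h4 h5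
  linear_combination h3 - h1 + h2 + h4 - h5

/-- The Riccati equation for P = `phiH` along ξ: the nullity condition on (X, ξ), with ∇ξ = P - φ
substituted. -/
lemma cov_xi_phiH_aux (X : V) :
    L.cov (L.phiH φ ξ) ξ X = - L.phiH φ ξ (L.phiH φ ξ X)
      - (1 + algebraMap ℝ C κ) • φ (φ X) - algebraMap ℝ C μ • φ (L.phiH φ ξ X) := by
  have h1 := H.nullity X ξ
  rw [R_xi, L.cov_shape φ, L.cov_shape φ, H.cov_xi_eq_zero] at h1
  simp only [cov, H.phiH_xi, H.phi_xi, H.h_eq, H.eta_xi, nabla_xi (φ := φ) (ξ := ξ), map_zero, map_sub,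
    H.phiH_phi] at h1
  simp only [cov, H.phi_sq] at h1 ⊢
  linear_combination (norm := module) -h1

/-- Since ∇_ξφ = 0, the endomorphism ∇_ξP anticommutes with φ, as P does. In the Riccati equation φP
also anticommutes with φ, while P² and φ² commute with it, so the commuting part P² + (1+κ)φ² must
vanish. -/
lemma phiH_sq (X : V) :
    L.phiH φ ξ (L.phiH φ ξ X) = - (1 + algebraMap ℝ C κ) • φ (φ X) := by
  have h1 := H.cov_phiH_phi ξ X
  rw [H.cov_xi_eq_zero, H.cov_xi_eq_zero, H.cov_xi_phiH_aux, H.cov_xi_phiH_aux] at h1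
  simp only [H.phiH_phi, map_neg, map_sub, map_smul, map_zero] at h1
  have h2 : (2 : C) • φ (L.phiH φ ξ (L.phiH φ ξ X) + (1 + algebraMap ℝ C κ) • φ (φ X)) = 0 := by
    simp only [map_add, map_smul]
    linear_combination (norm := module) -h1
  have h3 := congrArg (fun v ↦ algebraMap ℝ C (1 / 2) • φ v) h2
  simp only [map_smul, smul_smul, half_mul_two, one_smul, H.phi_sq, map_add, map_sub, H.eta_phiH,
    H.eta_xi, map_zero, smul_zero] at h3
  simp only [H.phi_sq]
  linear_combination (norm := module) h3

lemma cov_xi_phiH (X : V) :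
    L.cov (L.phiH φ ξ) ξ X = - algebraMap ℝ C μ • φ (L.phiH φ ξ X) := by
  rw [H.cov_xi_phiH_aux, H.phiH_sq]
  module

lemma cov_phiH_phiH (X Z : V) :
    L.cov (L.phiH φ ξ) X (L.phiH φ ξ Z) + L.phiH φ ξ (L.cov (L.phiH φ ξ) X Z) =
      (1 + algebraMap ℝ C κ) • (L.g Z (L.nabla X ξ) • ξ + η Z • L.nabla X ξ) := by
  have e : (1 + algebraMap ℝ C κ) = algebraMap ℝ C (1 + κ) := by simp
  simp only [cov, H.phiH_sq, H.phi_sq, map_sub, L.nabla_smul, H.D_eta, e, neg_smul, map_neg,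
    Derivation.map_algebraMap]
  module

/-- The difference of two covariant derivatives of `φ h` on horizontal fields. -/
lemma g_cov_phiH_sub {Y Z : V} (hY : η Y = 0) (hZ : η Z = 0) (X : V) :
    L.g X (L.cov (L.phiH φ ξ) Y Z) - L.g X (L.cov (L.phiH φ ξ) Z Y) = L.g Y (L.cov φ X Z) := by
  -- For horizontal Y and Z the nullity condition is R_{YZ}ξ = 0. The two ∇φ terms that appear merge
  -- into one by closedness of the fundamental form.
  have h1 := congrArg (L.g X) (H.nullity Y Z)
  rw [R_xi, L.cov_shape φ, L.cov_shape φ] at h1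
  simp only [hY, hZ, zero_smul, sub_zero, smul_zero, add_zero, map_sub, map_zero] at h1
  linear_combination h1 - H.cov_phi_cyclic X Y Z + H.g_cov_phi Y X Z

end IsKappaMu

/-- Horizontal eigenvectors of `φ h`. -/
def IsEig (φ : V →ₗ[C] V) (ξ : V) (η : V →ₗ[C] C) (l : C) (X : V) : Prop :=
  L.phiH φ ξ X = l • X ∧ η X = 0

namespace IsKappaMu

variable {L} {φ : V →ₗ[C] V} {ξ : V} {η : V →ₗ[C] C} {h : V → V} {κ μ : ℝ}
  (H : L.IsKappaMu φ ξ η h κ μ)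

include H

lemma phi_eig {l : C} {X : V} (hX : L.IsEig φ ξ η l X) : L.IsEig φ ξ η (-l) (φ X) :=
  ⟨by rw [H.phiH_phi, hX.1]; simp, H.eta_phi X⟩

lemma phi_eig_neg {l : C} {X : V} (hX : L.IsEig φ ξ η (-l) X) : L.IsEig φ ξ η l (φ X) := by
  simpa using H.phi_eig hX

/-- Differentiating P² = -(1+κ)φ² shows that ∇P anticommutes with P up to terms in ξ and η. Between
two eigenvectors for l this leaves 2l g(Y, (∇_X P)Z) = 0, and l is invertible. -/
lemma g_cov_phiH_eig {l i : C} (hi : i * l = 1) {Y Z : V} (hY : L.IsEig φ ξ η l Y)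
    (hZ : L.IsEig φ ξ η l Z) (X : V) : L.g Y (L.cov (L.phiH φ ξ) X Z) = 0 := by
  have h1 := congrArg (L.g Y) (H.cov_phiH_phiH X Z)
  rw [hZ.1, L.cov_smul_right, map_add, ← H.phiH_symm, hY.1, hZ.2] at h1
  simp only [map_smul, map_add, H.g_xi, hY.2, smul_eq_mul, LinearMap.smul_apply] at h1
  apply eq_zero_of_two_mul
  linear_combination i * h1 - 2 * (L.g Y (L.cov (L.phiH φ ξ) X Z)) * hi

lemma g_cov_phi_eig {l i : C} (hi : i * l = 1) {X Y Z : V} (hX : L.IsEig φ ξ η l X)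
    (hY : L.IsEig φ ξ η l Y) (hZ : L.IsEig φ ξ η l Z) : L.g Y (L.cov φ X Z) = 0 := by
  rw [← H.g_cov_phiH_sub hY.2 hZ.2, H.g_cov_phiH_eig hi hX hZ, H.g_cov_phiH_eig hi hX hY, sub_zero]

/-- On ker η, ∇φ anticommutes with φ modulo ξ. This carries statements about D(l) over to D(-l). -/
lemma g_phi_cov_phi_phi {Y Z : V} (hY : η Y = 0) (hZ : η Z = 0) (X : V) :
    L.g (φ Y) (L.cov φ X (φ Z)) = L.g Y (L.cov φ X Z) := by
  have h1 := congrArg (L.g (φ Y)) (H.cov_phi_phi X Z)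
  simp only [map_add, H.metric_phi, hY, hZ, map_sub, map_smul, H.g_xi, H.eta_phi, smul_eq_mul] at h1
  linear_combination h1

lemma g_cov_phi_eig_neg {l i : C} (hi : i * l = 1) {X Y Z : V} (hX : L.IsEig φ ξ η l X)
    (hY : L.IsEig φ ξ η (-l) Y) (hZ : L.IsEig φ ξ η (-l) Z) : L.g Y (L.cov φ X Z) = 0 := by
  rw [← H.g_phi_cov_phi_phi hY.2 hZ.2]
  exact H.g_cov_phi_eig hi hX (H.phi_eig_neg hY) (H.phi_eig_neg hZ)

lemma phi_phi_of_eta {X : V} (hX : η X = 0) : φ (φ X) = X := by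
  rw [H.phi_sq, hX, zero_smul, sub_zero]

/-- Put T(X, Y, W) = g(Y, (∇_Xφ)φW) on D(l). Closedness makes T symmetric in X, Y (`sym`), because
the third cyclic term vanishes; skewness of ∇φ and its anticommutation with φ make T alternate in Y,
W (`alt`). A trilinear form symmetric in the first two slots and skew in the last two is zero. -/
lemma g_cov_phi_eig_mixed {l i : C} (hi : i * l = 1) {X Y Z : V} (hX : L.IsEig φ ξ η l X)
    (hY : L.IsEig φ ξ η l Y) (hZ : L.IsEig φ ξ η (-l) Z) : L.g Y (L.cov φ X Z) = 0 := by
  have hi' : -i * -l = 1 := by linear_combination hi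
  have sym {X Y W : V} (hX : L.IsEig φ ξ η l X) (hY : L.IsEig φ ξ η l Y)
      (hW : L.IsEig φ ξ η l W) : L.g Y (L.cov φ X (φ W)) = L.g X (L.cov φ Y (φ W)) := by
    have h1 := H.cov_phi_cyclic X Y (φ W)
    rw [H.g_cov_phi_eig_neg (l := -l) hi' (H.phi_eig hW) (by simpa using hX) (by simpa using hY)]
      at h1
    linear_combination h1 - H.g_cov_phi Y X (φ W)
  have alt {X Y W : V} (hY : L.IsEig φ ξ η l Y)
      (hW : L.IsEig φ ξ η l W) : L.g Y (L.cov φ X (φ W)) = - L.g W (L.cov φ X (φ Y)) := by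
    have h1 := H.g_phi_cov_phi_phi (H.eta_phi Y) hW.2 X
    rw [H.phi_phi_of_eta hY.2] at h1
    rw [h1, H.g_cov_phi]
  have hW := H.phi_eig_neg hZ
  rw [← H.phi_phi_of_eta hZ.2]
  set W := φ Z
  apply eq_zero_of_two_mul
  linear_combination alt (X := X) hY hW - sym hX hW hY - alt (X := W) hX hY
    + sym hW hY hX + alt (X := Y) hW hX - sym hY hX hW

lemma exists_eig_add_eig {l i : C} (hi : i * l = 1) (hl : l * l = - (1 + algebraMap ℝ C κ))
    {X : V} (hX : η X = 0) :
    ∃ X₁ X₂, L.IsEig φ ξ η l X₁ ∧ L.IsEig φ ξ η (-l) X₂ ∧ X₁ + X₂ = X := by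
  have hP : L.phiH φ ξ (L.phiH φ ξ X) = (l * l) • X := by
    rw [H.phiH_sq, hl, H.phi_phi_of_eta hX]
  have e : i * (l * l) = l := by linear_combination l * hi
  have e' : (i * l) • L.phiH φ ξ X = L.phiH φ ξ X := by rw [hi, one_smul]
  -- The spectral projections ½(1 ± l⁻¹P), available because P² = l² on ker η.
  refine ⟨algebraMap ℝ C (1 / 2) • (X + i • L.phiH φ ξ X),
    algebraMap ℝ C (1 / 2) • (X - i • L.phiH φ ξ X), ⟨?_, ?_⟩, ⟨?_, ?_⟩, ?_⟩
  · simp only [map_smul, map_add, hP, smul_smul, e]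
    linear_combination (norm := module) -algebraMap ℝ C (1 / 2) • e'
  · simp [hX, H.eta_phiH]
  · simp only [map_smul, map_sub, hP, smul_smul, e]
    linear_combination (norm := module) -algebraMap ℝ C (1 / 2) • e'
  · simp [hX, H.eta_phiH]
  · rw [← smul_add, show X + i • L.phiH φ ξ X + (X - i • L.phiH φ ξ X) = (2 : C) • X by module,
      smul_smul, half_mul_two, one_smul]

lemma g_cov_phi_horizontal {l i : C} (hi : i * l = 1) (hl : l * l = - (1 + algebraMap ℝ C κ))
    {X Y Z : V} (hX : η X = 0) (hY : η Y = 0) (hZ : η Z = 0) : L.g Y (L.cov φ X Z) = 0 := by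
  have key {l i : C} (hi : i * l = 1) (hl : l * l = - (1 + algebraMap ℝ C κ)) {X : V}
      (hX : L.IsEig φ ξ η l X) : L.g Y (L.cov φ X Z) = 0 := by
    obtain ⟨Y₁, Y₂, hY₁, hY₂, rfl⟩ := H.exists_eig_add_eig hi hl hY
    obtain ⟨Z₁, Z₂, hZ₁, hZ₂, rfl⟩ := H.exists_eig_add_eig hi hl hZ
    simp only [L.cov_add_right, map_add, LinearMap.add_apply]
    rw [H.g_cov_phi_eig hi hX hY₁ hZ₁, H.g_cov_phi_eig_mixed hi hX hY₁ hZ₂, H.g_cov_phi _ Y₂ Z₁,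
      H.g_cov_phi_eig_mixed hi hX hZ₁ hY₂, H.g_cov_phi_eig_neg hi hX hY₂ hZ₂]
    simp
  obtain ⟨X₁, X₂, hX₁, hX₂, rfl⟩ := H.exists_eig_add_eig hi hl hX
  rw [L.cov_add_left, map_add, key hi hl hX₁, key (l := -l) (i := -i) (by simpa) (by rw [neg_mul_neg, hl]) hX₂,
    add_zero]

/-- With the horizontal part of ∇φ gone, the Codazzi equation and the symmetry of P make g(Y, (∇_X
P)Z) totally symmetric on ker η. Among three eigenvectors two share an eigenvalue; moved into the
slots Y and Z, they give zero by `g_cov_phiH_eig`. -/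
lemma g_cov_phiH_horizontal {l i : C} (hi : i * l = 1) (hl : l * l = - (1 + algebraMap ℝ C κ))
    {X Y Z : V} (hX : η X = 0) (hY : η Y = 0) (hZ : η Z = 0) :
    L.g Y (L.cov (L.phiH φ ξ) X Z) = 0 := by
  have swap {X Y Z : V} (hX : η X = 0) (hY : η Y = 0) (hZ : η Z = 0) :
      L.g Y (L.cov (L.phiH φ ξ) X Z) = L.g Y (L.cov (L.phiH φ ξ) Z X) := by
    have := H.g_cov_phiH_sub hX hZ Y
    rw [H.g_cov_phi_horizontal hi hl hY hX hZ] at this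
    linear_combination this
  have hi' : -i * -l = 1 := by linear_combination hi
  obtain ⟨X₁, X₂, hX₁, hX₂, rfl⟩ := H.exists_eig_add_eig hi hl hX
  obtain ⟨Y₁, Y₂, hY₁, hY₂, rfl⟩ := H.exists_eig_add_eig hi hl hY
  obtain ⟨Z₁, Z₂, hZ₁, hZ₂, rfl⟩ := H.exists_eig_add_eig hi hl hZ
  simp only [L.cov_add_left, L.cov_add_right, map_add, LinearMap.add_apply]
  rw [H.g_cov_phiH_eig hi hY₁ hZ₁, H.g_cov_phiH_eig hi hY₁ hZ₁, H.g_cov_phiH_eig hi' hY₂ hZ₂,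
    H.g_cov_phiH_eig hi' hY₂ hZ₂,
    swap hX₁.2 hY₁.2 hZ₂.2, H.g_cov_phiH_eig hi hY₁ hX₁,
    swap hX₂.2 hY₂.2 hZ₁.2, H.g_cov_phiH_eig hi' hY₂ hX₂,
    H.phiH_symm_cov X₂ Y₁ Z₂, swap hX₂.2 hZ₂.2 hY₁.2, H.g_cov_phiH_eig hi' hZ₂ hX₂,
    H.phiH_symm_cov X₁ Y₂ Z₁, swap hX₁.2 hZ₁.2 hY₂.2, H.g_cov_phiH_eig hi hZ₁ hX₁]
  simp

lemma eta_sub (X : V) : η (X - η X • ξ) = 0 := by simp [H.eta_xi]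

/-- Each argument is split into a horizontal part and a multiple of ξ. The purely horizontal
component is zero, and those involving ξ follow from ∇_ξφ = 0 and φξ = 0. The next lemma is
analogous, with ∇_ξP = -μφP producing the μ-term. -/
lemma cov_phi_eq {l i : C} (hi : i * l = 1) (hl : l * l = - (1 + algebraMap ℝ C κ)) (X Z : V) :
    L.cov φ X Z = L.g Z (φ (L.nabla X ξ)) • ξ - η Z • φ (L.nabla X ξ) := by
  refine L.ext_g fun Y ↦ ?_
  rw [L.g_symm, L.g_symm _ Y]
  have h0 := H.g_cov_phi_horizontal hi hl (H.eta_sub X) (H.eta_sub Y) (H.eta_sub Z)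
  have h1 := H.g_cov_phi X ξ Z
  have h2 := H.g_xi_left (φ (L.nabla X ξ))
  simp only [sub_eq_add_neg, ← neg_smul, L.cov_add_left, L.cov_add_right, L.cov_smul_left,
    L.cov_smul_right, H.cov_xi_eq_zero, H.cov_phi_xi, map_add, map_smul, LinearMap.add_apply,
    LinearMap.smul_apply, smul_eq_mul, map_neg, map_zero, H.g_xi] at h0 h1 ⊢
  rw [H.eta_phi] at h2
  linear_combination h0 + η Y * h1 + η Z * η Y * h2

lemma cov_phiH_eq {l i : C} (hi : i * l = 1) (hl : l * l = - (1 + algebraMap ℝ C κ)) (X Z : V) :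
    L.cov (L.phiH φ ξ) X Z = - L.g Z (L.phiH φ ξ (L.nabla X ξ)) • ξ
      - η Z • L.phiH φ ξ (L.nabla X ξ) - (algebraMap ℝ C μ * η X) • φ (L.phiH φ ξ Z) := by
  refine L.ext_g fun Y ↦ ?_
  rw [L.g_symm, L.g_symm _ Y]
  have h0 := H.g_cov_phiH_horizontal hi hl (H.eta_sub X) (H.eta_sub Y) (H.eta_sub Z)
  have h1 := H.phiH_symm_cov X ξ Z
  have h2 := H.g_xi_left (L.phiH φ ξ (L.nabla X ξ))
  have h3 : L.cov (L.phiH φ ξ) X ξ = - L.phiH φ ξ (L.nabla X ξ) := by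
    simp [cov, H.phiH_xi]
  have h4 := H.g_xi_left (φ (L.phiH φ ξ Z))
  rw [H.eta_phi] at h4
  simp only [sub_eq_add_neg, ← neg_smul, L.cov_add_left, L.cov_add_right, L.cov_smul_left,
    L.cov_smul_right, H.cov_xi_phiH, h3, map_add, map_smul, LinearMap.add_apply,
    LinearMap.smul_apply, smul_eq_mul, map_neg, map_zero, H.g_xi, H.phiH_xi] at h0 h1 ⊢
  rw [H.eta_phiH] at h2
  linear_combination h0 + η Y * h1 + η Z * η Y * h2 + η X * η Y * algebraMap ℝ C μ * h4

/-- The Ricci identity for φ. Pairing with a horizontal W discards all multiples of ξ, so no second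
derivative of ξ survives; η(∇_X Z) is rewritten by differentiating η(Z) = 0. -/
lemma g_R_phi {l i : C} (hi : i * l = 1) (hl : l * l = - (1 + algebraMap ℝ C κ)) (X Y : V)
    {Z W : V} (hZ : η Z = 0) (hW : η W = 0) :
    L.g (L.R X Y (φ Z)) W + L.g (L.R X Y Z) (φ W) =
      (L.g Z (φ (L.nabla Y ξ)) * L.g (L.nabla X ξ) W
        - L.g Z (L.nabla X ξ) * L.g (φ (L.nabla Y ξ)) W)
      - (L.g Z (φ (L.nabla X ξ)) * L.g (L.nabla Y ξ) W
        - L.g Z (L.nabla Y ξ) * L.g (φ (L.nabla X ξ)) W) := by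
  have hD (X) : η (L.nabla X Z) + L.g Z (L.nabla X ξ) = 0 := by rw [← H.D_eta, hZ, map_zero]
  have h1 := congrArg (fun v ↦ L.g v W) (L.ricci φ X Y Z)
  simp only [H.cov_phi_eq hi hl, map_sub, L.nabla_smul, LinearMap.sub_apply, map_add,
    LinearMap.add_apply, map_smul, LinearMap.smul_apply, smul_eq_mul, H.g_xi_left, hW, hZ, map_zero, H.g_phi_left (L.R X Y Z)] at h1
  linear_combination h1 + L.g (φ (L.nabla Y ξ)) W * hD X - L.g (φ (L.nabla X ξ)) W * hD Y

/-- As for φ. The extra term comes from the factor η(X) in ∇P: its skewed derivative is 2g(X, φY).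
-/
lemma g_R_phiH {l i : C} (hi : i * l = 1) (hl : l * l = - (1 + algebraMap ℝ C κ)) (X Y : V)
    {Z W : V} (hZ : η Z = 0) (hW : η W = 0) :
    L.g (L.R X Y (L.phiH φ ξ Z)) W - L.g (L.R X Y Z) (L.phiH φ ξ W) =
      - (L.g Z (L.phiH φ ξ (L.nabla Y ξ)) * L.g (L.nabla X ξ) W
        + L.g Z (L.nabla X ξ) * L.g (L.phiH φ ξ (L.nabla Y ξ)) W)
      + (L.g Z (L.phiH φ ξ (L.nabla X ξ)) * L.g (L.nabla Y ξ) W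
        + L.g Z (L.nabla Y ξ) * L.g (L.phiH φ ξ (L.nabla X ξ)) W)
      - 2 * algebraMap ℝ C μ * L.g X (φ Y) * L.g (φ (L.phiH φ ξ Z)) W := by
  have hD (X) : η (L.nabla X Z) + L.g Z (L.nabla X ξ) = 0 := by rw [← H.D_eta, hZ, map_zero]
  have h1 := congrArg (fun v ↦ L.g v W) (L.ricci (L.phiH φ ξ) X Y Z)
  have h2 := H.g_nabla_xi X Y
  rw [L.g_symm _ Y, L.g_symm _ X] at h2
  simp only [H.cov_phiH_eq hi hl, map_sub, L.nabla_smul, LinearMap.sub_apply, map_add,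
    LinearMap.add_apply, map_smul, LinearMap.smul_apply, smul_eq_mul, H.g_xi_left, hW, hZ, neg_smul,
    map_neg, LinearMap.neg_apply, L.nabla_map φ, L.nabla_map (L.phiH φ ξ), H.cov_phi_eq hi hl,
    L.D_algebraMap_mul, H.eta_phiH, H.phi_xi, map_zero, LinearMap.zero_apply,
    H.D_eta, H.phiH_symm (L.R X Y Z)] at h1
  linear_combination h1 - algebraMap ℝ C μ * L.g (φ (L.phiH φ ξ Z)) W * h2
    + L.g (L.phiH φ ξ (L.nabla Y ξ)) W * hD X
    - L.g (L.phiH φ ξ (L.nabla X ξ)) W * hD Y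

end IsKappaMu
end LeviCivitaModule

/-! ### Determination of the curvature tensor. -/

namespace LeviCivitaModule

variable {C V : Type*} [CommRing C] [Algebra ℝ C] [AddCommGroup V] [Module C V]
  (L : LeviCivitaModule C V)

/-- The curvature expression of a paracontact metric `(κ, μ)`-manifold, with `b = μ / 2` and
`c = (b - 1) / (κ + 1)`. -/
def kappaMuForm (φ : V →ₗ[C] V) (ξ : V) (η : V →ₗ[C] C) (k b c : C) (X Y Z W : V) : C :=
  (-1 + b) * (L.g Y Z * L.g X W - L.g X Z * L.g Y W)
  + L.g Y Z * L.g (φ (L.phiH φ ξ X)) W - L.g X Z * L.g (φ (L.phiH φ ξ Y)) W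
  - L.g Y W * L.g (φ (L.phiH φ ξ X)) Z + L.g X W * L.g (φ (L.phiH φ ξ Y)) Z
  + c * (L.g (φ (L.phiH φ ξ Y)) Z * L.g (φ (L.phiH φ ξ X)) W
    - L.g (φ (L.phiH φ ξ X)) Z * L.g (φ (L.phiH φ ξ Y)) W)
  - b * (L.g (φ Y) Z * L.g (φ X) W - L.g (φ X) Z * L.g (φ Y) W)
  + (-1 - c) * (L.g (L.phiH φ ξ Y) Z * L.g (L.phiH φ ξ X) W
    - L.g (L.phiH φ ξ Y) W * L.g (L.phiH φ ξ X) Z)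
  + 2 * b * L.g (φ X) Y * L.g (φ Z) W
  + η X * η W * ((k + 1 - b) * L.g Y Z + (2 * b - 1) * L.g (φ (L.phiH φ ξ Y)) Z)
  - η X * η Z * ((k + 1 - b) * L.g Y W + (2 * b - 1) * L.g (φ (L.phiH φ ξ Y)) W)
  + η Y * η Z * ((k + 1 - b) * L.g X W + (2 * b - 1) * L.g (φ (L.phiH φ ξ X)) W)
  - η Y * η W * ((k + 1 - b) * L.g X Z + (2 * b - 1) * L.g (φ (L.phiH φ ξ X)) Z)

namespace IsKappaMu

variable {L} {φ : V →ₗ[C] V} {ξ : V} {η : V →ₗ[C] C} {h : V → V} {κ μ : ℝ}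
  (H : L.IsKappaMu φ ξ η h κ μ)

include H

/-- A linear functional vanishes if it vanishes on `ξ` and on the eigenvectors of `φ h`. -/
lemma eq_zero_of_eig {l i : C} (hi : i * l = 1) (hl : l * l = - (1 + algebraMap ℝ C κ))
    {q : V → C} (add : ∀ X Y, q (X + Y) = q X + q Y) (smul : ∀ (f : C) X, q (f • X) = f * q X)
    (h_xi : q ξ = 0) (h1 : ∀ X, L.IsEig φ ξ η l X → q X = 0)
    (h2 : ∀ X, L.IsEig φ ξ η (-l) X → q X = 0) (X : V) : q X = 0 := by
  obtain ⟨X₁, X₂, hX₁, hX₂, e⟩ := H.exists_eig_add_eig hi hl (H.eta_sub X)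
  have e' : X = (X₁ + X₂) + η X • ξ := by rw [e]; abel
  rw [e', add, smul, add, h1 X₁ hX₁, h2 X₂ hX₂, h_xi]
  simp

/-- An algebraic curvature tensor annihilated by `ξ` and commuting with `φ` and `φ h` on horizontal
vectors vanishes. -/
lemma curvature_form_eq_zero {l i : C} (hi : i * l = 1) (hl : l * l = - (1 + algebraMap ℝ C κ))
    {F : V → V → V → V → C} (add : ∀ X Y Z W W', F X Y Z (W + W') = F X Y Z W + F X Y Z W')
    (smul : ∀ (f : C) X Y Z W, F X Y Z (f • W) = f * F X Y Z W)
    (skew : ∀ X Y Z W, F X Y W Z = - F X Y Z W) (pair : ∀ X Y Z W, F X Y Z W = F Z W X Y)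
    (cyclic : ∀ X Y Z W, F X Y Z W + F Y Z X W + F Z X Y W = 0)
    (h_xi : ∀ X Y W, F X Y ξ W = 0)
    (comm_P : ∀ X Y Z W, η X = 0 → η Y = 0 → η Z = 0 → η W = 0 →
      F X Y (L.phiH φ ξ Z) W = F X Y Z (L.phiH φ ξ W))
    (comm_phi : ∀ X Y Z W, η X = 0 → η Y = 0 → η Z = 0 → η W = 0 →
      F X Y (φ Z) W = - F X Y Z (φ W)) (X Y Z W : V) : F X Y Z W = 0 := by
  have smul₃ (f : C) (X Y Z W : V) : F X Y (f • Z) W = f * F X Y Z W := by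
    rw [skew, smul, skew]; ring
  -- F(X, Y, ·, ·) is compatible with P, so different eigenspaces are orthogonal for it. Pair
  -- symmetry gives the same for the first two slots.
  have mixed {X Y Z W : V} (hX : η X = 0) (hY : η Y = 0) (hZ : L.IsEig φ ξ η l Z)
      (hW : L.IsEig φ ξ η (-l) W) : F X Y Z W = 0 := by
    have h1 := comm_P X Y Z W hX hY hZ.2 hW.2
    rw [hZ.1, hW.1, smul, smul₃] at h1
    apply eq_zero_of_two_mul
    linear_combination i * h1 - 2 * F X Y Z W * hi
  have mixed' {X Y Z W : V} (hX : L.IsEig φ ξ η l X) (hY : L.IsEig φ ξ η (-l) Y) (hZ : η Z = 0)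
      (hW : η W = 0) : F X Y Z W = 0 := by
    rw [pair, mixed hZ hW hX hY]
  have swap (X Y Z W : V) : F Y X Z W = - F X Y Z W := by
    rw [pair, skew, pair]
  -- In the cyclic identity, the two other terms have a first pair from different eigenspaces.
  have opp {X Y Z W : V} (hX : L.IsEig φ ξ η l X) (hY : L.IsEig φ ξ η l Y)
      (hZ : L.IsEig φ ξ η (-l) Z) (hW : η W = 0) : F X Y Z W = 0 := by
    have h1 := cyclic X Y Z W
    rw [mixed' hY hZ hX.2 hW, swap X Z, mixed' hX hZ hY.2 hW] at h1
    linear_combination h1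
  -- Writing Z = φ(φZ) and moving one φ across puts φZ in the opposite eigenspace, where `opp`
  -- applies.
  have same {X Y Z W : V} (hX : L.IsEig φ ξ η l X) (hY : L.IsEig φ ξ η l Y)
      (hZ : L.IsEig φ ξ η l Z) (hW : η W = 0) : F X Y Z W = 0 := by
    rw [← H.phi_phi_of_eta hZ.2, comm_phi _ _ _ _ hX.2 hY.2 (H.eta_phi Z) hW,
      opp hX hY (H.phi_eig hZ) (H.eta_phi W), neg_zero]
  have same' {X Y Z W : V} (hX : L.IsEig φ ξ η (-l) X) (hY : L.IsEig φ ξ η (-l) Y)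
      (hZ : L.IsEig φ ξ η (-l) Z) (hW : L.IsEig φ ξ η (-l) W) : F X Y Z W = 0 := by
    rw [← H.phi_phi_of_eta hZ.2, comm_phi _ _ _ _ hX.2 hY.2 (H.eta_phi Z) hW.2, pair,
      opp (H.phi_eig_neg hZ) (H.phi_eig_neg hW) hX hY.2, neg_zero]
  have add₃ (X Y Z Z' W : V) : F X Y (Z + Z') W = F X Y Z W + F X Y Z' W := by
    rw [skew, add, skew X Y W Z, skew X Y W Z']; ring
  refine H.eq_zero_of_eig hi hl (q := fun W ↦ F X Y Z W) (add X Y Z) (fun f ↦ smul f X Y Z) ?_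
    (fun W hW ↦ ?_) (fun W hW ↦ ?_) W
  · rw [skew, h_xi, neg_zero]
  all_goals
    refine H.eq_zero_of_eig hi hl (q := fun Z ↦ F X Y Z W) (fun _ _ ↦ add₃ _ _ _ _ _)
      (fun f _ ↦ smul₃ _ _ _ _ _) (h_xi X Y W) (fun Z hZ ↦ ?_) (fun Z hZ ↦ ?_) Z
    all_goals
      rw [pair]
      refine H.eq_zero_of_eig hi hl (q := fun Y ↦ F Z W X Y) (add _ _ _) (fun f ↦ smul f _ _ _) ?_
        (fun Y hY ↦ ?_) (fun Y hY ↦ ?_) Y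
      · rw [skew, h_xi, neg_zero]
      all_goals
        refine H.eq_zero_of_eig hi hl (q := fun X ↦ F Z W X Y) (fun _ _ ↦ add₃ _ _ _ _ _)
          (fun f _ ↦ smul₃ _ _ _ _ _) (h_xi _ _ _) (fun X hX ↦ ?_) (fun X hX ↦ ?_) X
        all_goals
          first
          | exact same hZ hW hX hY.2
          | exact same' hZ hW hX hY
          | exact mixed' hZ hW hX.2 hY.2
          | exact mixed hZ.2 hW.2 hX hY
          | exact opp hZ hW hX hY.2
          | (rw [pair]; exact opp hX hY hZ hW.2)
          | (rw [skew, mixed hZ.2 hW.2 hY hX, neg_zero])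
          | (rw [swap, mixed' hW hZ hX.2 hY.2, neg_zero])

lemma g_phi_phiH (X Y : V) : L.g X (φ (L.phiH φ ξ Y)) = L.g Y (φ (L.phiH φ ξ X)) := by
  rw [H.skew, H.phiH_symm, H.phiH_phi, map_neg, neg_neg]

lemma g_phiH (X Y : V) : L.g X (L.phiH φ ξ Y) = L.g Y (L.phiH φ ξ X) := by
  rw [← H.phiH_symm, L.g_symm]

/-- Applies `curvature_form_eq_zero` to the difference of the two sides. The relation `hc` encodes c
= (b-1)/(1+k) without dividing in the algebra C. -/
lemma g_R_eq {l i k b c : C} (hi : i * l = 1) (hl : l * l = - (1 + algebraMap ℝ C κ))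
    (hk : algebraMap ℝ C κ = k) (hb : algebraMap ℝ C μ = 2 * b) (hc : b = 1 + (1 + k) * c)
    (X Y Z W : V) :
    L.g (L.R X Y Z) W = L.kappaMuForm φ ξ η k b c X Y Z W := by
  rw [← sub_eq_zero]
  refine H.curvature_form_eq_zero hi hl
    (F := fun X Y Z W ↦ L.g (L.R X Y Z) W - L.kappaMuForm φ ξ η k b c X Y Z W)
    ?_ ?_ ?_ ?_ ?_ ?_ ?_ ?_ X Y Z W <;> clear X Y Z W
  · intro X Y Z W W'
    simp only [kappaMuForm, map_add]
    ring
  · intro f X Y Z W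
    simp only [kappaMuForm, map_smul, smul_eq_mul]
    ring
  · intro X Y Z W
    simp only [L.g_R_swap_right X Y W Z]
    simp only [kappaMuForm, H.g_phi_left, H.phiH_symm, H.phiH_phi, map_neg, H.skew W Z]
    ring
  · intro X Y Z W
    simp only [L.g_R_pair X Y Z W]
    simp only [kappaMuForm, H.g_phi_left, H.phiH_symm, H.phiH_phi, map_neg]
    simp only [L.g_symm Z X, L.g_symm Z Y, L.g_symm W X, L.g_symm W Y, H.g_phi_phiH Z X,
      H.g_phi_phiH Z Y, H.g_phi_phiH W X, H.g_phi_phiH W Y,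
      H.g_phiH Z X, H.g_phiH Z Y, H.g_phiH W X, H.g_phiH W Y, H.skew Z X, H.skew Z Y, H.skew W X,
        H.skew W Y]
    ring
  · intro X Y Z W
    have hR := congrArg (fun v ↦ L.g v W) (L.R_cyclic X Y Z)
    simp only [map_add, LinearMap.add_apply, map_zero, LinearMap.zero_apply] at hR
    simp only [kappaMuForm, H.g_phi_left, H.phiH_symm, H.phiH_phi, map_neg]
    simp only [L.g_symm Y X, H.skew Y X, H.g_phiH Y X, H.g_phi_phiH Y X, L.g_symm Z X, H.skew Z X,
      H.g_phiH Z X, H.g_phi_phiH Z X, L.g_symm Z Y, H.skew Z Y, H.g_phiH Z Y, H.g_phi_phiH Z Y]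
    linear_combination hR
  · intro X Y W
    simp only [H.nullity, H.h_eq, kappaMuForm, H.g_phi_left, H.phiH_symm, H.phiH_phi, map_neg,
      H.g_xi,
      H.phi_xi, H.phiH_xi, H.eta_xi, map_add, map_sub, map_smul,
      LinearMap.add_apply, LinearMap.sub_apply, LinearMap.smul_apply, smul_eq_mul, map_zero,
        LinearMap.zero_apply, hk, hb]
    ring
  -- The commutators of the explicit form with P, and below with φ, must agree with those from the
  -- Ricci identity. Eliminating b through `hc` makes this a polynomial identity.
  · intro X Y Z W hX hY hZ hW
    have hR := H.g_R_phiH hi hl X Y hZ hW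
    rw [hb] at hR
    simp only [kappaMuForm, nabla_xi (φ := φ) (ξ := ξ), map_sub, LinearMap.sub_apply,
      H.g_phi_left, H.phiH_symm, H.phiH_phi, map_neg, H.phiH_sq, hk, H.phi_phi_of_eta, H.eta_phiH, hX, hY, hZ, hW,
      map_smul, LinearMap.smul_apply, smul_eq_mul, neg_neg, neg_smul, LinearMap.neg_apply] at hR ⊢
    simp only [L.g_symm Z X, H.skew Z X,
      H.g_phiH Z X, H.g_phi_phiH Z X, L.g_symm Z Y, H.skew Z Y, H.g_phiH Z Y, H.g_phi_phiH Z Y] at hR ⊢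
    subst hc
    linear_combination hR
  · intro X Y Z W hX hY hZ hW
    have hR := H.g_R_phi hi hl X Y hZ hW
    simp only [kappaMuForm, nabla_xi (φ := φ) (ξ := ξ), map_sub, LinearMap.sub_apply,
      H.g_phi_left, H.phiH_symm, H.phiH_phi, map_neg, H.phi_phi_of_eta, H.eta_phi,
        hX, hY, hZ, hW,
      neg_neg] at hR ⊢
    simp only [L.g_symm Z X, H.skew Z X,
      H.g_phiH Z X, H.g_phi_phiH Z X, L.g_symm Z Y, H.skew Z Y, H.g_phiH Z Y, H.g_phi_phiH Z Y] at hR ⊢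
    subst hc
    linear_combination hR

end IsKappaMu
end LeviCivitaModule

/-! ### Smoothness of brackets, directional derivatives and the Levi-Civita connection. -/

section SmoothFields

variable {E : Type*} [NormedAddCommGroup E] [NormedSpace ℝ E] [FiniteDimensional ℝ E]
    [CompleteSpace E]
    {H : Type*} [TopologicalSpace H] {I : ModelWithCorners ℝ E H}
    {M : Type*} [TopologicalSpace M] [ChartedSpace H M] [IsManifold I ∞ M]
    {X Y Z W : Π x : M, TangentSpace I x} {x : M} {f : M → ℝ}

open Filter Topology

lemma isManifold_minSmoothness_three : IsManifold I (minSmoothness ℝ 3) M :=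
  IsManifold.of_le (n := ∞) (by
    rw [minSmoothness_of_isRCLikeNormedField]; exact WithTop.coe_le_coe.2 (le_top : (3 : ℕ∞) ≤ ⊤))

namespace SmoothFieldAt

lemma mdifferentiableAt (hX : SmoothFieldAt X x) : MDiffAt (T% X) x :=
  ContMDiffAt.mdifferentiableAt hX (by simp)

lemma eventually_mdifferentiableAt (hX : SmoothFieldAt X x) : ∀ᶠ y in 𝓝 x, MDiffAt (T% X) y := by
  -- Smoothness of order ∞ at x need not give one neighbourhood for all orders; being C¹ at a point
  -- does spread to a neighbourhood.
  have h1 : CMDiffAt 1 (T% X) x := ContMDiffAt.of_le hX (by simp)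
  filter_upwards [(contMDiffAt_iff_contMDiffAt_nhds (by simp)).1 h1] with y hy
  exact ContMDiffAt.mdifferentiableAt hy (by simp)

lemma add (hX : SmoothFieldAt X x) (hY : SmoothFieldAt Y x) : SmoothFieldAt (X + Y) x :=
  ContMDiffAt.add_section hX hY

lemma smul (hf : CMDiffAt ∞ f x) (hX : SmoothFieldAt X x) : SmoothFieldAt (f • X) x :=
  ContMDiffAt.smul_section hf hX

lemma congr (hX : SmoothFieldAt X x) (h : ∀ᶠ y in 𝓝 x, Y y = X y) : SmoothFieldAt Y x :=
  ContMDiffAt.congr_of_eventuallyEq hX (h.mono fun y hy ↦ by simp [hy])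

lemma extend (v : TangentSpace I x) : SmoothFieldAt (FiberBundle.extend E v) x :=
  FiberBundle.contMDiffAt_extend ..

lemma mlieBracket (hX : SmoothFieldAt X x) (hY : SmoothFieldAt Y x) :
    SmoothFieldAt (mlieBracket I X Y) x := by
  have : IsManifold I (minSmoothness ℝ 3) M := isManifold_minSmoothness_three
  have : IsManifold I ((⊤ : ℕ∞) + 1) M := by simpa using! (inferInstance : IsManifold I ∞ M)
  exact ContMDiffAt.mlieBracket_vectorField (n := ⊤) (m := ⊤) hX hY (by simp)

end SmoothFieldAt

lemma ContMDiffAt.mvfderiv_apply (hf : CMDiffAt ∞ f x) (hX : SmoothFieldAt X x) :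
    CMDiffAt ∞ (fun y ↦ mvfderiv I f y (X y)) x := by
  have h1 : ContMDiffAt I 𝓘(ℝ, E →L[ℝ] ℝ) ∞
    (inTangentCoordinates I 𝓘(ℝ) id f (mfderiv I 𝓘(ℝ) f) x) x := hf.mfderiv_const (by simp)
  have h2 := ContMDiffAt.clm_apply_of_inCoordinates (b₁ := id) (b₂ := f) h1 hX hf
  rw [contMDiffAt_totalSpace] at h2
  have h3 := h2.2
  simp at h3
  exact h3

lemma exists_smoothFieldAt_ne_zero [Nontrivial E] (x : M) :
    ∃ Z : Π x : M, TangentSpace I x, SmoothFieldAt Z x ∧ Z x ≠ 0 := by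
  obtain ⟨v, hv⟩ := exists_ne (0 : E)
  exact ⟨FiberBundle.extend E (show TangentSpace I x from v), .extend _, by
    rw [FiberBundle.extend_apply_self]; exact hv⟩

/-- The derivation along a Lie bracket is the commutator of the derivations. -/
lemma mvfderiv_mlieBracket (hf : CMDiffAt ∞ f x) (hX : SmoothFieldAt X x)
    (hY : SmoothFieldAt Y x) :
    mvfderiv I (fun y ↦ mvfderiv I f y (Y y)) x (X x)
      - mvfderiv I (fun y ↦ mvfderiv I f y (X y)) x (Y x) = mvfderiv I f x (mlieBracket I X Y x) := by
  rcases subsingleton_or_nontrivial E with hE | hE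
  · have h0 (v : TangentSpace I x) : v = 0 := Subsingleton.elim (α := E) v 0
    simp [h0 (X x), h0 (Y x), h0 (mlieBracket I X Y x)]
  -- The identity is read off from the Jacobi identity for X, Y, fZ: after Leibniz expansion and
  -- subtraction of f times the identity for Z, the defect remains as a coefficient of Z(x) ≠ 0.
  obtain ⟨Z, hZ, hZx⟩ := exists_smoothFieldAt_ne_zero (I := I) x
  have : IsManifold I (minSmoothness ℝ 3) M := isManifold_minSmoothness_three
  have hf1 : ∀ᶠ y in 𝓝 x, MDiffAt f y := by
    have h1 : CMDiffAt 1 f x := hf.of_le (by simp)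
    filter_upwards [(contMDiffAt_iff_contMDiffAt_nhds (by simp)).1 h1] with y hy
    exact ContMDiffAt.mdifferentiableAt hy (by simp)
  have key {X Y : Π x : M, TangentSpace I x} (hX : SmoothFieldAt X x) (hY : SmoothFieldAt Y x) :
      mlieBracket I X (mlieBracket I Y (f • Z)) x =
        f x • mlieBracket I X (mlieBracket I Y Z) x + mvfderiv I f x (X x) • mlieBracket I Y Z x
        + mvfderiv I f x (Y x) • mlieBracket I X Z x
        + mvfderiv I (fun y ↦ mvfderiv I f y (Y y)) x (X x) • Z x := by
    have h1 : mlieBracket I Y (f • Z) =ᶠ[𝓝 x]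
        f • mlieBracket I Y Z + (fun y ↦ mvfderiv I f y (Y y)) • Z := by
      filter_upwards [hf1, hZ.eventually_mdifferentiableAt] with y h1 h2
      rw [mlieBracket_smul_right h1 h2]
      exact add_comm _ _
    have hd := hf.mvfderiv_apply hY
    rw [Filter.EventuallyEq.rfl.mlieBracket_vectorField_eq h1,
      mlieBracket_add_right ((hY.mlieBracket hZ).smul hf).mdifferentiableAt
        (hZ.smul hd).mdifferentiableAt,
      mlieBracket_smul_right (hf.mdifferentiableAt (by simp)) (hY.mlieBracket hZ).mdifferentiableAt,
      mlieBracket_smul_right (hd.mdifferentiableAt (by simp)) hZ.mdifferentiableAt]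
    abel
  have le2 : minSmoothness ℝ 2 ≤ ∞ := by
    rw [minSmoothness_of_isRCLikeNormedField]; exact WithTop.coe_le_coe.2 (le_top : (2 : ℕ∞) ≤ ⊤)
  have jac (W : Π x : M, TangentSpace I x) (hW : SmoothFieldAt W x) :=
    leibniz_identity_mlieBracket_apply (ContMDiffAt.of_le hX le2) (ContMDiffAt.of_le hY le2)
      (ContMDiffAt.of_le hW le2)
  have h1 := jac _ (hZ.smul hf)
  have h2 := jac _ hZ
  rw [key hX hY, key hY hX,
    mlieBracket_smul_right (hf.mdifferentiableAt (by simp)) hZ.mdifferentiableAt, h2] at h1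
  have h3 : (mvfderiv I (fun y ↦ mvfderiv I f y (Y y)) x (X x)
      - mvfderiv I (fun y ↦ mvfderiv I f y (X y)) x (Y x)
      - mvfderiv I f x (mlieBracket I X Y x)) • Z x = 0 := by
    linear_combination (norm := module) h1
  exact sub_eq_zero.1 ((smul_eq_zero.1 h3).resolve_right hZx)

/-- Solutions of linear systems with smooth coefficients are smooth. -/
lemma contMDiffAt_of_linear_system {ι : Type*} [Fintype ι] [DecidableEq ι]
    {A : ι × ι → M → ℝ} (hA : ∀ p, CMDiffAt ∞ (A p) x) {c : ι → M → ℝ}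
    (h0 : ∀ v : ι → ℝ, (∀ j, ∑ i, v i * A (i, j) x = 0) → v = 0)
    (hc : ∀ j, CMDiffAt ∞ (fun y ↦ ∑ i, c i y * A (i, j) y) x) (i : ι) :
    CMDiffAt ∞ (c i) x := by
  -- The coefficients are assembled into an operator G(y) on ι → ℝ. It is invertible at x, and
  -- inversion is smooth there, so c = G⁻¹(Gc) is smooth.
  obtain ⟨T, hT, hTa⟩ : ∃ T : (ι × ι → ℝ) → (ι → ℝ) →L[ℝ] (ι → ℝ), ContDiff ℝ ∞ T ∧
      ∀ a v j, T a v j = ∑ i, v i * a (i, j) := by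
    refine ⟨fun a ↦ ∑ i, ∑ j, a (i, j) •
      (ContinuousLinearMap.proj i : (ι → ℝ) →L[ℝ] ℝ).smulRight (Pi.single j 1 : ι → ℝ),
      by fun_prop, fun a v j ↦ ?_⟩
    simp only [sum_apply, _root_.smul_apply, Finset.sum_apply, Pi.smul_apply,
      ContinuousLinearMap.smulRight_apply, ContinuousLinearMap.proj_apply, smul_eq_mul,
      Pi.single_apply, mul_ite, mul_one, mul_zero, Finset.sum_ite_eq, Finset.mem_univ, if_true]
    exact Finset.sum_congr rfl fun _ _ ↦ mul_comm _ _
  let G (y : M) : (ι → ℝ) →L[ℝ] (ι → ℝ) := T fun p ↦ A p y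
  have hG : ContMDiffAt I 𝓘(ℝ, (ι → ℝ) →L[ℝ] (ι → ℝ)) ∞ G x :=
    hT.contMDiff.contMDiffAt.comp x (contMDiffAt_pi_space.2 hA)
  have hunit : IsUnit (G x) := by
    rw [ContinuousLinearMap.isUnit_iff_bijective]
    have hinj : Function.Injective (G x).toLinearMap := by
      rw [injective_iff_map_eq_zero]
      exact fun v hv ↦ h0 v fun j ↦ (hTa _ v j).symm.trans (congrFun hv j)
    exact ⟨hinj, LinearMap.injective_iff_surjective.1 hinj⟩
  have hw : ContMDiffAt I 𝓘(ℝ, ι → ℝ) ∞ (fun y ↦ G y fun i ↦ c i y) x := by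
    refine contMDiffAt_pi_space.2 fun j ↦ (hc j).congr_of_eventuallyEq (.of_forall fun y ↦ ?_)
    exact hTa (fun p ↦ A p y) (fun i ↦ c i y) j
  have hinv : ContMDiffAt I 𝓘(ℝ, (ι → ℝ) →L[ℝ] (ι → ℝ)) ∞ (fun y ↦ Ring.inverse (G y)) x := by
    have h1 : ContDiffAt ℝ ∞ Ring.inverse (G x) := by
      obtain ⟨u, hu⟩ := hunit
      rw [← hu]
      exact contDiffAt_ringInverse ℝ u
    exact h1.contMDiffAt.comp x hG
  have hev : ∀ᶠ y in 𝓝 x, IsUnit (G y) :=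
    hG.continuousAt.eventually (Units.isOpen.mem_nhds hunit)
  have h2 : ContMDiffAt I 𝓘(ℝ, ι → ℝ) ∞ (fun y i ↦ c i y) x := by
    refine (hinv.clm_apply hw).congr_of_eventuallyEq ?_
    filter_upwards [hev] with y hy
    rw [← mul_apply_eq_comp, Ring.inverse_mul_cancel _ hy]
    rfl
  exact contMDiffAt_pi_space.1 h2 i

namespace PseudoRiemannianMetric

variable (g : PseudoRiemannianMetric I M)

lemma contMDiffAt_val (hX : SmoothFieldAt X x) (hY : SmoothFieldAt Y x) :
    CMDiffAt ∞ (fun y ↦ g.val y (X y) (Y y)) x := by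
  have h : ContMDiffAt I (I.prod 𝓘(ℝ)) ∞ (fun y ↦ TotalSpace.mk' ℝ
      (E := Bundle.Trivial M ℝ) y (g.val y (X y) (Y y))) x :=
    ContMDiffAt.clm_bundle_apply₂ (F₁ := E) (F₂ := E) (g.contMDiff x) hX hY
  rw [contMDiffAt_totalSpace] at h
  exact h.2

lemma contMDiffAt_koszul (hX : SmoothFieldAt X x) (hY : SmoothFieldAt Y x)
    (hZ : SmoothFieldAt Z x) : CMDiffAt ∞ (g.koszul X Y Z) x := by
  have h {A B C : Π x : M, TangentSpace I x} (hA : SmoothFieldAt A x) (hB : SmoothFieldAt B x)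
      (hC : SmoothFieldAt C x) := (g.contMDiffAt_val hA hB).mvfderiv_apply hC
  have h' {A B C : Π x : M, TangentSpace I x} (hA : SmoothFieldAt A x) (hB : SmoothFieldAt B x)
      (hC : SmoothFieldAt C x) := g.contMDiffAt_val (hA.mlieBracket hB) hC
  exact contMDiffAt_const.mul (((((h hX hZ hY).add (h hY hZ hX)).sub (h hY hX hZ)).add
    (h' hY hX hZ)).sub (h' hY hZ hX) |>.sub (h' hX hZ hY))

lemma val_leviCivita (hX : MDiffAt (T% X) x) (hY : MDiffAt (T% Y) x) (hZ : MDiffAt (T% Z) x) :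
    g.val x (g.leviCivita X x (Y x)) (Z x) = g.koszul X Y Z x := by
  have e1 := g.isLeviCivita_leviCivita.metric (Y x) hX hZ
  have e2 := g.isLeviCivita_leviCivita.metric (X x) hY hZ
  have e3 := g.isLeviCivita_leviCivita.metric (Z x) hY hX
  have t := @g.isLeviCivita_leviCivita.torsion_free
  rw [koszul, e1, e2, e3, ← t hY hX, ← t hY hZ, ← t hX hZ]
  simp only [map_sub, _root_.sub_apply]
  rw [g.symm x (X x) (g.leviCivita Z x (Y x)), g.symm x (Y x) (g.leviCivita Z x (X x)),
    g.symm x (Y x) (g.leviCivita X x (Z x))]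
  ring

/-- In a local frame the coefficients of V solve a linear system whose matrix is the Gram matrix of
the frame, invertible by nondegeneracy of g. With the Koszul formula this yields smoothness of ∇. -/
lemma smoothFieldAt_of_val {V : Π x : M, TangentSpace I x}
    (h : ∀ Z, SmoothFieldAt Z x → CMDiffAt ∞ (fun y ↦ g.val y (V y) (Z y)) x) :
    SmoothFieldAt V x := by
  let t := trivializationAt E (TangentSpace I : M → Type _) x
  have hx : x ∈ t.baseSet := FiberBundle.mem_baseSet_trivializationAt E _ x
  let b := Module.finBasis ℝ E
  let e := t.localFrame b
  have he (i) : SmoothFieldAt (e i) x := contMDiffAt_localFrame_of_mem ∞ _ b i hx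
  have hsum (v : Fin (Module.finrank ℝ E) → ℝ) (y : M) (j) :
      ∑ i, v i * g.val y (e i y) (e j y) = g.val y (∑ i, v i • e i y) (e j y) := by
    rw [map_sum, sum_apply]
    simp
  rw [SmoothFieldAt, contMDiffAt_iff_localFrameCoeff b hx]
  refine contMDiffAt_of_linear_system (fun p ↦ g.contMDiffAt_val (he p.1) (he p.2))
    (fun v hv ↦ ?_) (fun j ↦ (h (e j) (he j)).congr_of_eventuallyEq ?_)
  · have h0 : ∑ i, v i • e i x = 0 := by
      refine g.nondegenerate x _ fun w ↦ ?_
      rw [← (t.basisAt b hx).sum_repr w, map_sum]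
      refine Finset.sum_eq_zero fun j _ ↦ ?_
      rw [map_smul, ← t.localFrame_apply_of_mem_baseSet b hx, ← hsum]
      exact (congrArg _ (hv j)).trans (smul_zero _)
    have hli := (t.basisAt b hx).linearIndependent
    rw [Fintype.linearIndependent_iff] at hli
    funext i
    refine hli v ?_ i
    simpa only [e, t.localFrame_apply_of_mem_baseSet b hx] using h0
  · filter_upwards [t.open_baseSet.mem_nhds hx] with y hy
    rw [hsum]
    exact congrArg (fun v ↦ g.val y v (e j y)) (t.eq_sum_localFrameCoeff_smul hy).symm

lemma smoothFieldAt_leviCivita (hX : SmoothFieldAt X x) (hY : SmoothFieldAt Y x) :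
    SmoothFieldAt (fun y ↦ g.leviCivita X y (Y y)) x := by
  refine g.smoothFieldAt_of_val fun Z hZ ↦ (g.contMDiffAt_koszul hX hY hZ).congr_of_eventuallyEq ?_
  filter_upwards [hX.eventually_mdifferentiableAt, hY.eventually_mdifferentiableAt,
    hZ.eventually_mdifferentiableAt] with y h1 h2 h3
  exact g.val_leviCivita h1 h2 h3

end PseudoRiemannianMetric

end SmoothFields

/-! ### Symmetries and tensoriality of the curvature on the manifold. -/

section SmoothFields

variable {E : Type*} [NormedAddCommGroup E] [NormedSpace ℝ E] [FiniteDimensional ℝ E]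
    [CompleteSpace E]
    {H : Type*} [TopologicalSpace H] {I : ModelWithCorners ℝ E H}
    {M : Type*} [TopologicalSpace M] [ChartedSpace H M] [IsManifold I ∞ M]
    {X Y Z W : Π x : M, TangentSpace I x} {x : M}

open Filter Topology

lemma mvfderiv_congr {f f' : M → ℝ} (h : f =ᶠ[𝓝 x] f') : mvfderiv I f x = mvfderiv I f' x := by
  ext v
  simp only [mvfderiv, h.mfderiv_eq]
  rfl

namespace PseudoRiemannianMetric

variable (g : PseudoRiemannianMetric I M)

lemma leviCivita_congr (hX : MDiffAt (T% X) x) (h : ∀ᶠ y in 𝓝 x, Y y = X y) :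
    g.leviCivita Y x = g.leviCivita X x :=
  (g.leviCivita.isCovariantDerivativeOn (s := Set.univ)).congr_of_eventuallyEq
    (hX.congr_of_eventuallyEq (h.mono fun y hy ↦ by simp [hy])) hX Filter.univ_mem h

lemma leviCivita_add (hX : MDiffAt (T% X) x) (hY : MDiffAt (T% Y) x) :
    g.leviCivita (X + Y) x = g.leviCivita X x + g.leviCivita Y x :=
  (g.leviCivita.isCovariantDerivativeOn (s := Set.univ)).add hX hY

lemma leviCivita_sub (hX : MDiffAt (T% X) x) (hY : MDiffAt (T% Y) x) :
    g.leviCivita (X - Y) x = g.leviCivita X x - g.leviCivita Y x := by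
  rw [eq_sub_iff_add_eq, ← g.leviCivita_add (mdifferentiableAt_sub_section hX hY) hY, sub_add_cancel]

lemma leviCivita_smul {f : M → ℝ} (hf : MDiffAt f x) (hX : MDiffAt (T% X) x)
    (v : TangentSpace I x) : g.leviCivita (f • X) x v =
      f x • g.leviCivita X x v + mvfderiv I f x v • X x := by
  rw [(g.leviCivita.isCovariantDerivativeOn (s := Set.univ)).leibniz hX hf]
  simp

lemma leviCivita_sub_leviCivita (hX : MDiffAt (T% X) x) (hY : MDiffAt (T% Y) x) :
    g.leviCivita Y x (X x) - g.leviCivita X x (Y x) = mlieBracket I X Y x :=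
  g.isLeviCivita_leviCivita.torsion_free hX hY

lemma curvature_swap : g.curvature X Y Z x = - g.curvature Y X Z x := by
  simp only [curvature, mlieBracket_swap_apply (V := X) (W := Y), map_neg]
  abel

lemma val_curvature_swap_right (hX : SmoothFieldAt X x) (hY : SmoothFieldAt Y x)
    (hZ : SmoothFieldAt Z x) (hW : SmoothFieldAt W x) :
    g.val x (g.curvature X Y Z x) (W x) = - g.val x (g.curvature X Y W x) (Z x) := by
  have m {A B : Π x : M, TangentSpace I x} (hA : SmoothFieldAt A x) (hB : SmoothFieldAt B x)
    (v : TangentSpace I x) := g.isLeviCivita_leviCivita.metric v hA.mdifferentiableAt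
      hB.mdifferentiableAt
  have key {A B : Π x : M, TangentSpace I x} (hA : SmoothFieldAt A x) (hB : SmoothFieldAt B x) :
      mvfderiv I (fun y ↦ mvfderiv I (fun y ↦ g.val y (Z y) (W y)) y (B y)) x (A x) =
        g.val x (g.leviCivita (fun y ↦ g.leviCivita Z y (B y)) x (A x)) (W x)
        + g.val x (g.leviCivita Z x (B x)) (g.leviCivita W x (A x))
        + g.val x (g.leviCivita Z x (A x)) (g.leviCivita W x (B x))
        + g.val x (Z x) (g.leviCivita (fun y ↦ g.leviCivita W y (B y)) x (A x)) := by
    have hZB := g.smoothFieldAt_leviCivita hZ hB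
    have hWB := g.smoothFieldAt_leviCivita hW hB
    have h1 : (fun y ↦ mvfderiv I (fun y ↦ g.val y (Z y) (W y)) y (B y)) =ᶠ[𝓝 x]
        (fun y ↦ g.val y (g.leviCivita Z y (B y)) (W y))
          + fun y ↦ g.val y (Z y) (g.leviCivita W y (B y)) := by
      filter_upwards [hZ.eventually_mdifferentiableAt, hW.eventually_mdifferentiableAt]
        with y h1 h2
      exact g.isLeviCivita_leviCivita.metric (B y) h1 h2
    rw [mvfderiv_congr h1, mvfderiv_add
      (g.mdifferentiableAt_val hZB.mdifferentiableAt hW.mdifferentiableAt)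
      (g.mdifferentiableAt_val hZ.mdifferentiableAt hWB.mdifferentiableAt), add_apply,
      m hZB hW, m hZ hWB]
    ring
  have h := mvfderiv_mlieBracket (g.contMDiffAt_val hZ hW) hX hY
  rw [key hX hY, key hY hX, m hZ hW] at h
  simp only [curvature, map_sub, sub_apply, g.symm x _ (Z x)] at h ⊢
  linear_combination h

/-- The Jacobi identity, with every bracket written as a difference of covariant derivatives. -/
lemma curvature_cyclic (hX : SmoothFieldAt X x) (hY : SmoothFieldAt Y x)
    (hZ : SmoothFieldAt Z x) :
    g.curvature X Y Z x + g.curvature Y Z X x + g.curvature Z X Y x = 0 := by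
  have key {A B C : Π x : M, TangentSpace I x} (hA : SmoothFieldAt A x) (hB : SmoothFieldAt B x)
      (hC : SmoothFieldAt C x) : mlieBracket I A (mlieBracket I B C) x =
        g.leviCivita (fun y ↦ g.leviCivita C y (B y)) x (A x)
        - g.leviCivita (fun y ↦ g.leviCivita B y (C y)) x (A x)
        - g.leviCivita A x (mlieBracket I B C x) := by
    have h1 : ∀ᶠ y in 𝓝 x, mlieBracket I B C y =
        ((fun y ↦ g.leviCivita C y (B y)) - fun y ↦ g.leviCivita B y (C y)) y := by
      filter_upwards [hB.eventually_mdifferentiableAt, hC.eventually_mdifferentiableAt]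
        with y h1 h2
      exact (g.leviCivita_sub_leviCivita h1 h2).symm
    have hBC := (g.smoothFieldAt_leviCivita hC hB).mdifferentiableAt
    have hCB := (g.smoothFieldAt_leviCivita hB hC).mdifferentiableAt
    rw [← g.leviCivita_sub_leviCivita hA.mdifferentiableAt (hB.mlieBracket hC).mdifferentiableAt,
      g.leviCivita_congr (mdifferentiableAt_sub_section hBC hCB) h1, g.leviCivita_sub hBC hCB]
    rfl
  have : IsManifold I (minSmoothness ℝ 3) M := isManifold_minSmoothness_three
  have le2 : minSmoothness ℝ 2 ≤ ∞ := by
    rw [minSmoothness_of_isRCLikeNormedField]; exact WithTop.coe_le_coe.2 (le_top : (2 : ℕ∞) ≤ ⊤)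
  have jac := leibniz_identity_mlieBracket_apply (ContMDiffAt.of_le hX le2)
    (ContMDiffAt.of_le hY le2) (ContMDiffAt.of_le hZ le2)
  rw [mlieBracket_swap_apply (V := mlieBracket I X Y), key hX hY hZ, key hY hX hZ,
    key hZ hX hY] at jac
  have h1 : mlieBracket I X Z x = - mlieBracket I Z X x := mlieBracket_swap_apply
  simp only [h1, map_neg] at jac
  simp only [curvature]
  linear_combination (norm := module) jac

lemma val_curvature_pair (hX : SmoothFieldAt X x) (hY : SmoothFieldAt Y x)
    (hZ : SmoothFieldAt Z x) (hW : SmoothFieldAt W x) :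
    g.val x (g.curvature X Y Z x) (W x) = g.val x (g.curvature Z W X x) (Y x) := by
  have b {X Y Z W : Π x : M, TangentSpace I x} (hX : SmoothFieldAt X x) (hY : SmoothFieldAt Y x)
      (hZ : SmoothFieldAt Z x) : g.val x (g.curvature X Y Z x) (W x)
        + g.val x (g.curvature Y Z X x) (W x) + g.val x (g.curvature Z X Y x) (W x) = 0 := by
    simpa using congrArg (fun v ↦ g.val x v (W x)) (g.curvature_cyclic hX hY hZ)
  have s (X Y Z W : Π x : M, TangentSpace I x) : g.val x (g.curvature Y X Z x) (W x) =
      - g.val x (g.curvature X Y Z x) (W x) := by simp [g.curvature_swap (X := Y) (Y := X)]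
  have r {X Y Z W : Π x : M, TangentSpace I x} := g.val_curvature_swap_right
    (X := X) (Y := Y) (Z := Z) (W := W) (x := x)
  linear_combination (b (W := W) hX hY hZ + b (W := X) hY hZ hW - b (W := Y) hZ hW hX
    - b (W := Z) hW hX hY - r hY hZ hW hX - r hZ hW hY hX + s Z X W Y - r hZ hX hW hY
    + r hW hX hY hZ + r hX hY hW hZ + s W Y X Z - r hW hY hX hZ) / 2

lemma eq_of_val_eq_smooth {u v : TangentSpace I x}
    (h : ∀ W : Π x : M, TangentSpace I x, SmoothFieldAt W x → g.val x u (W x) = g.val x v (W x)) :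
    u = v := by
  rw [← sub_eq_zero]
  refine g.nondegenerate x _ fun w ↦ ?_
  have := h (FiberBundle.extend E w) (.extend w)
  simpa [sub_eq_zero] using this

/-- The curvature at a point depends only on the values of the fields at that point. -/
lemma curvature_congr {X' Y' Z' : Π x : M, TangentSpace I x} (hX : SmoothFieldAt X x)
    (hY : SmoothFieldAt Y x) (hZ : SmoothFieldAt Z x) (hX' : SmoothFieldAt X' x)
    (hY' : SmoothFieldAt Y' x) (hZ' : SmoothFieldAt Z' x) (eX : X' x = X x) (eY : Y' x = Y x)
    (eZ : Z' x = Z x) : g.curvature X' Y' Z' x = g.curvature X Y Z x := by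
  -- Skew-symmetry exchanges the third field with the test field, which enters only by its value.
  -- Pair symmetry then extends this to the first two fields.
  have third {A B C C' : Π x : M, TangentSpace I x} (hA : SmoothFieldAt A x)
      (hB : SmoothFieldAt B x) (hC : SmoothFieldAt C x) (hC' : SmoothFieldAt C' x)
      (e : C' x = C x) {W : Π x : M, TangentSpace I x} (hW : SmoothFieldAt W x) :
      g.val x (g.curvature A B C' x) (W x) = g.val x (g.curvature A B C x) (W x) := by
    rw [g.val_curvature_swap_right hA hB hC' hW, e, ← g.val_curvature_swap_right hA hB hC hW]
  refine g.eq_of_val_eq_smooth fun W hW ↦ ?_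
  rw [third hX' hY' hZ hZ' eZ hW, g.val_curvature_pair hX' hY' hZ hW,
    third hZ hW hX hX' eX hY', eY, ← g.val_curvature_pair hX hY hZ hW]

end PseudoRiemannianMetric

end SmoothFields

/-! ### Smooth functions and fields on an open set, and derivations. -/

noncomputable section SmoothFields

variable {E : Type*} [NormedAddCommGroup E] [NormedSpace ℝ E] [FiniteDimensional ℝ E]
    [CompleteSpace E]
    {H : Type*} [TopologicalSpace H] {I : ModelWithCorners ℝ E H}
    {M : Type*} [TopologicalSpace M] [ChartedSpace H M] [IsManifold I ∞ M]
    {X Y Z W : Π x : M, TangentSpace I x} {x : M}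

open Filter Topology

lemma SmoothFieldAt.neg (hX : SmoothFieldAt X x) : SmoothFieldAt (-X) x :=
  ContMDiffAt.neg_section hX

lemma SmoothFieldAt.zero : SmoothFieldAt (0 : Π x : M, TangentSpace I x) x :=
  contMDiff_zeroSection ℝ (TangentSpace I : M → Type _) x

namespace IsAlmostParacontact

variable {n : ℕ} {φ : Π x : M, TangentSpace I x →L[ℝ] TangentSpace I x}
    {ξ : Π x : M, TangentSpace I x} {η : Π x : M, TangentSpace I x →L[ℝ] ℝ}
    (hM : IsAlmostParacontact n φ ξ η)

include hM

lemma mdifferentiableAt_phi (hX : MDiffAt (T% X) x) : MDiffAt (T% fun y ↦ φ y (X y)) x :=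
  MDifferentiableAt.clm_bundle_apply (F₁ := E) (F₂ := E)
    ((hM.smooth_phi x).mdifferentiableAt (by simp)) hX

lemma smoothFieldAt_phi (hX : SmoothFieldAt X x) : SmoothFieldAt (fun y ↦ φ y (X y)) x :=
  ContMDiffAt.clm_bundle_apply (F₁ := E) (F₂ := E) (hM.smooth_phi x) hX

lemma smoothFieldAt_xi : SmoothFieldAt ξ x := hM.smooth_xi x

lemma contMDiffAt_eta (hX : SmoothFieldAt X x) : CMDiffAt ∞ (fun y ↦ η y (X y)) x := by
  have h : ContMDiffAt I (I.prod 𝓘(ℝ)) ∞ (fun y ↦ TotalSpace.mk' ℝ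
      (E := Bundle.Trivial M ℝ) y (η y (X y))) x :=
    ContMDiffAt.clm_bundle_apply (F₁ := E) (F₂ := ℝ) (hM.smooth_eta x) hX
  rw [contMDiffAt_totalSpace] at h
  exact h.2

lemma tensorialAt_paraH : TensorialAt I E (fun X ↦ paraH φ ξ X x) x where
  smul {f X} hf hX := by
    have h1 : (fun y ↦ φ y ((f • X) y)) = f • fun y ↦ φ y (X y) := by ext1 y; simp
    simp only [paraH, h1, mlieBracket_smul_right hf (hM.mdifferentiableAt_phi hX),
      mlieBracket_smul_right hf hX, map_add, map_smul]
    module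
  add {X Y} hX hY := by
    have h1 : (fun y ↦ φ y ((X + Y) y)) = (fun y ↦ φ y (X y)) + fun y ↦ φ y (Y y) := by
      ext1 y; simp
    simp only [paraH, h1, mlieBracket_add_right (hM.mdifferentiableAt_phi hX)
      (hM.mdifferentiableAt_phi hY), mlieBracket_add_right hX hY, map_add]
    module

lemma paraH_congr (hX : SmoothFieldAt X x) (hY : SmoothFieldAt Y x) (h : X x = Y x) :
    paraH φ ξ X x = paraH φ ξ Y x :=
  hM.tensorialAt_paraH.pointwise hX.mdifferentiableAt hY.mdifferentiableAt h

end IsAlmostParacontact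

open TopologicalSpace (Opens)

variable (I) in
/-- The algebra of smooth functions on an open subset of a manifold. -/
def smoothFunctionsOn (U : Opens M) : Subalgebra ℝ (U → ℝ) where
  carrier := {f | ∀ y ∈ U, CMDiffAt ∞ (Function.extend Subtype.val f 0) y}
  mul_mem' {f g} hf hg y hy := by
    have h : Function.extend Subtype.val (f * g) 0 =
        Function.extend Subtype.val f 0 * Function.extend (Subtype.val : U → M) g 0 := by
      rw [← Function.extend_mul, mul_zero]
    rw [h]
    exact (hf y hy).mul (hg y hy)
  add_mem' {f g} hf hg y hy := by
    have h : Function.extend Subtype.val (f + g) 0 =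
        Function.extend Subtype.val f 0 + Function.extend (Subtype.val : U → M) g 0 := by
      rw [← Function.extend_add, add_zero]
    rw [h]
    exact (hf y hy).add (hg y hy)
  algebraMap_mem' r y hy := by
    refine (contMDiffAt_const (c := r)).congr_of_eventuallyEq ?_
    filter_upwards [U.isOpen.mem_nhds hy] with z hz
    exact Subtype.val_injective.extend_apply (fun _ : U ↦ r) 0 ⟨z, hz⟩

variable (I) in
/-- The smooth vector fields on an open subset of a manifold, extended by zero. -/
def smoothFieldsOn (U : Opens M) : AddSubgroup (Π x : M, TangentSpace I x) where
  carrier := {X | (∀ y ∈ U, SmoothFieldAt X y) ∧ ∀ y ∉ U, X y = 0}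
  add_mem' hX hY := ⟨fun y hy ↦ (hX.1 y hy).add (hY.1 y hy), fun y hy ↦ by
    simp [hX.2 y hy, hY.2 y hy]⟩
  zero_mem' := ⟨fun _ _ ↦ .zero, fun _ _ ↦ rfl⟩
  neg_mem' hX := ⟨fun y hy ↦ (hX.1 y hy).neg, fun y hy ↦ by simp [hX.2 y hy]⟩

variable (I) in
/-- The smooth functions on an open subset of a manifold. -/
def SmoothFunctionOn (U : Opens M) : Type _ := smoothFunctionsOn I U

variable (I) in
/-- The smooth vector fields on an open subset of a manifold, extended by zero. -/
def SmoothFieldOn (U : Opens M) : Type _ := smoothFieldsOn I U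

variable {U : Opens M}

instance : CommRing (SmoothFunctionOn I U) := inferInstanceAs (CommRing (smoothFunctionsOn I U))

instance : Algebra ℝ (SmoothFunctionOn I U) := inferInstanceAs (Algebra ℝ (smoothFunctionsOn I U))

instance : AddCommGroup (SmoothFieldOn I U) := inferInstanceAs (AddCommGroup (smoothFieldsOn I U))

namespace SmoothFunctionOn

/-- The extension by zero. -/
def ext (f : SmoothFunctionOn I U) : M → ℝ := Function.extend Subtype.val f.1 0

lemma ext_apply (f : SmoothFunctionOn I U) (y : U) : f.ext y = f.1 y :=
  Subtype.val_injective.extend_apply ..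

lemma contMDiffAt (f : SmoothFunctionOn I U) {y : M} (hy : y ∈ U) : CMDiffAt ∞ f.ext y := f.2 y hy

lemma mdifferentiableAt (f : SmoothFunctionOn I U) {y : M} (hy : y ∈ U) : MDiffAt f.ext y :=
  (f.contMDiffAt hy).mdifferentiableAt (by simp)

lemma ext_add (f f' : SmoothFunctionOn I U) : (f + f').ext = f.ext + f'.ext := by
  unfold ext
  rw [← Function.extend_add, add_zero]
  rfl

lemma ext_mul (f f' : SmoothFunctionOn I U) : (f * f').ext = f.ext * f'.ext := by
  unfold ext
  rw [← Function.extend_mul, mul_zero]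
  rfl

lemma ext_smul (r : ℝ) (f : SmoothFunctionOn I U) : (r • f).ext = r • f.ext := by
  unfold ext
  rw [← Function.extend_smul, smul_zero]
  rfl

lemma ext_restrict_eq {F : M → ℝ} (hF : ∀ y ∉ U, F y = 0) :
    Function.extend (Subtype.val : U → M) (fun y ↦ F y) 0 = F := by
  funext y
  by_cases hy : y ∈ U
  · exact Subtype.val_injective.extend_apply _ _ (⟨y, hy⟩ : U)
  · rw [Function.extend_apply' _ _ _ (by rintro ⟨z, rfl⟩; exact hy z.2), hF y hy, Pi.zero_apply]

/-- The restriction of a function vanishing outside of `U`. -/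
def restrict (F : M → ℝ) (hF : ∀ y ∉ U, F y = 0) (h : ∀ y ∈ U, CMDiffAt ∞ F y) :
    SmoothFunctionOn I U :=
  ⟨fun y ↦ F y, fun y hy ↦ by rw [ext_restrict_eq hF]; exact h y hy⟩

lemma ext_restrict (F : M → ℝ) (hF : ∀ y ∉ U, F y = 0) (h : ∀ y ∈ U, CMDiffAt ∞ F y) :
    (restrict F hF h : SmoothFunctionOn I U).ext = F := ext_restrict_eq hF

@[ext] lemma ext_fun {f f' : SmoothFunctionOn I U} (h : ∀ y ∈ U, f.ext y = f'.ext y) : f = f' :=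
  Subtype.ext (funext fun y ↦ by rw [← ext_apply, ← ext_apply, h y y.2])

end SmoothFunctionOn

open SmoothFunctionOn (restrict)

namespace SmoothFieldOn

lemma smoothFieldAt (X : SmoothFieldOn I U) {y : M} (hy : y ∈ U) : SmoothFieldAt X.1 y := X.2.1 y hy

lemma mdifferentiableAt (X : SmoothFieldOn I U) {y : M} (hy : y ∈ U) : MDiffAt (T% X.1) y :=
  (X.smoothFieldAt hy).mdifferentiableAt

lemma eq_zero (X : SmoothFieldOn I U) {y : M} (hy : y ∉ U) : X.1 y = 0 := X.2.2 y hy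

@[ext] lemma ext_field {X Y : SmoothFieldOn I U} (h : ∀ y ∈ U, X.1 y = Y.1 y) : X = Y := by
  refine Subtype.ext (funext fun y ↦ ?_)
  by_cases hy : y ∈ U
  · exact h y hy
  · rw [X.eq_zero hy, Y.eq_zero hy]

instance : SMul (SmoothFunctionOn I U) (SmoothFieldOn I U) where
  smul f X := ⟨f.ext • X.1, fun _ hy ↦ (X.smoothFieldAt hy).smul (f.contMDiffAt hy),
    fun _ hy ↦ by simp [X.eq_zero hy]⟩

lemma smul_apply (f : SmoothFunctionOn I U) (X : SmoothFieldOn I U) (y : M) :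
    (f • X).1 y = f.ext y • X.1 y := rfl

lemma add_apply (X Y : SmoothFieldOn I U) (y : M) : (X + Y).1 y = X.1 y + Y.1 y := rfl

lemma sub_apply (X Y : SmoothFieldOn I U) (y : M) : (X - Y).1 y = X.1 y - Y.1 y := rfl

instance : Module (SmoothFunctionOn I U) (SmoothFieldOn I U) where
  one_smul X := by
    ext y hy
    rw [smul_apply, SmoothFunctionOn.ext_apply 1 ⟨y, hy⟩]
    exact one_smul _ _
  mul_smul f f' X := by
    ext y hy
    rw [smul_apply, smul_apply, smul_apply, SmoothFunctionOn.ext_mul, Pi.mul_apply, mul_smul]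
  smul_zero f := by ext y hy; exact smul_zero _
  zero_smul X := by
    ext y hy
    rw [smul_apply, SmoothFunctionOn.ext_apply 0 ⟨y, hy⟩]
    exact zero_smul _ _
  add_smul f f' X := by
    ext y hy
    rw [smul_apply, add_apply, smul_apply, smul_apply, SmoothFunctionOn.ext_add, Pi.add_apply,
      add_smul]
  smul_add f X Y := by ext y hy; exact smul_add ..

/-- The vector field `X` as a derivation of the algebra of smooth functions. -/
def derivation (X : SmoothFieldOn I U) :
    Derivation ℝ (SmoothFunctionOn I U) (SmoothFunctionOn I U) :=
  Derivation.mk'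
    { toFun f := restrict (fun y ↦ mvfderiv I f.ext y (X.1 y)) (fun y hy ↦ by simp [X.eq_zero hy])
        fun y hy ↦ (f.contMDiffAt hy).mvfderiv_apply (X.smoothFieldAt hy)
      map_add' f f' := by
        ext y hy
        simp only [SmoothFunctionOn.ext_add, SmoothFunctionOn.ext_restrict, Pi.add_apply]
        rw [mvfderiv_add (f.mdifferentiableAt hy) (f'.mdifferentiableAt hy)]
        rfl
      map_smul' r f := by
        ext y hy
        simp only [SmoothFunctionOn.ext_smul, SmoothFunctionOn.ext_restrict, Pi.smul_apply,
          RingHom.id_apply]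
        have h : r • f.ext = (fun _ ↦ r) * f.ext := rfl
        rw [h, mvfderiv_mul mdifferentiableAt_const (f.mdifferentiableAt hy), mvfderiv_const]
        simp }
    fun f f' ↦ by
      ext y hy
      simp only [LinearMap.coe_mk, AddHom.coe_mk, smul_eq_mul, SmoothFunctionOn.ext_mul,
        SmoothFunctionOn.ext_add, SmoothFunctionOn.ext_restrict, Pi.add_apply, Pi.mul_apply]
      rw [mvfderiv_mul (f.mdifferentiableAt hy) (f'.mdifferentiableAt hy)]
      simp

lemma ext_derivation (X : SmoothFieldOn I U) (f : SmoothFunctionOn I U) :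
    (X.derivation f).ext = fun y ↦ mvfderiv I f.ext y (X.1 y) :=
  SmoothFunctionOn.ext_restrict ..

end SmoothFieldOn

end SmoothFields

/-! ### Realization of the algebraic model by smooth fields. -/

noncomputable section SmoothFields

variable {E : Type*} [NormedAddCommGroup E] [NormedSpace ℝ E] [FiniteDimensional ℝ E]
    [CompleteSpace E]
    {H : Type*} [TopologicalSpace H] {I : ModelWithCorners ℝ E H}
    {M : Type*} [TopologicalSpace M] [ChartedSpace H M] [IsManifold I ∞ M]
    {x : M}

open Filter Topology
open TopologicalSpace (Opens)

variable {U : Opens M}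

open SmoothFunctionOn (restrict ext_restrict)
open SmoothFieldOn (ext_derivation)

namespace PseudoRiemannianMetric

variable (g : PseudoRiemannianMetric I M)

/-- The metric as a form on the smooth fields on `U`. -/
def form : SmoothFieldOn I U →ₗ[SmoothFunctionOn I U] SmoothFieldOn I U →ₗ[SmoothFunctionOn I U]
    SmoothFunctionOn I U :=
  LinearMap.mk₂ _
    (fun X Y ↦ restrict (fun y ↦ g.val y (X.1 y) (Y.1 y)) (fun y hy ↦ by simp [X.eq_zero hy])
      fun y hy ↦ g.contMDiffAt_val (X.smoothFieldAt hy) (Y.smoothFieldAt hy))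
    (fun X X' Y ↦ by
      ext y hy
      simp [SmoothFunctionOn.ext_add, ext_restrict, SmoothFieldOn.add_apply])
    (fun f X Y ↦ by
      ext y hy
      simp [SmoothFunctionOn.ext_mul, ext_restrict, SmoothFieldOn.smul_apply])
    (fun X Y Y' ↦ by
      ext y hy
      simp [SmoothFunctionOn.ext_add, ext_restrict, SmoothFieldOn.add_apply])
    (fun f X Y ↦ by
      ext y hy
      simp [SmoothFunctionOn.ext_mul, ext_restrict, SmoothFieldOn.smul_apply])

lemma ext_form (X Y : SmoothFieldOn I U) :
    (g.form X Y).ext = fun y ↦ g.val y (X.1 y) (Y.1 y) := ext_restrict ..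

/-- The covariant derivative of smooth fields on `U`. -/
def nablaOn (X Y : SmoothFieldOn I U) : SmoothFieldOn I U :=
  ⟨fun y ↦ g.leviCivita Y.1 y (X.1 y),
    fun _ hy ↦ g.smoothFieldAt_leviCivita (Y.smoothFieldAt hy) (X.smoothFieldAt hy),
    fun _ hy ↦ by simp [X.eq_zero hy]⟩

lemma nablaOn_apply (X Y : SmoothFieldOn I U) (y : M) :
    (g.nablaOn X Y).1 y = g.leviCivita Y.1 y (X.1 y) := rfl

lemma nablaOn_sub_nablaOn (X Y : SmoothFieldOn I U) {y : M} (hy : y ∈ U) :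
    (g.nablaOn X Y - g.nablaOn Y X).1 y = mlieBracket I X.1 Y.1 y :=
  g.leviCivita_sub_leviCivita (X.mdifferentiableAt hy) (Y.mdifferentiableAt hy)

lemma curvature_eq_nablaOn (X Y Z : SmoothFieldOn I U) {y : M} (hy : y ∈ U) :
    (g.nablaOn X (g.nablaOn Y Z) - g.nablaOn Y (g.nablaOn X Z)
      - g.nablaOn (g.nablaOn X Y - g.nablaOn Y X) Z).1 y = g.curvature X.1 Y.1 Z.1 y := by
  rw [curvature, ← g.nablaOn_sub_nablaOn X Y hy]
  rfl

/-- The algebraic model given by the smooth fields on an open set. -/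
def leviCivitaModule (hU : ∀ y ∈ U, ∀ v : TangentSpace I y, ∃ X : SmoothFieldOn I U, X.1 y = v) :
    LeviCivitaModule (SmoothFunctionOn I U) (SmoothFieldOn I U) where
  D := SmoothFieldOn.derivation
  g := g.form
  nabla :=
    { toFun X := AddMonoidHom.mk' (g.nablaOn X) fun Y Y' ↦ by
        ext y hy
        rw [SmoothFieldOn.add_apply, nablaOn_apply]
        exact congrArg (fun T ↦ T (X.1 y))
          (g.leviCivita_add (Y.mdifferentiableAt hy) (Y'.mdifferentiableAt hy))
      map_add' X X' := by
        ext Y y hy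
        exact map_add _ _ _
      map_smul' f X := by
        ext Y y hy
        exact map_smul _ _ _ }
  g_symm X Y := by
    ext y hy
    rw [ext_form, ext_form]
    exact g.symm _ _ _
  -- Pointwise nondegeneracy tests against every tangent vector, and `hU` realizes each of them by a
  -- field on U.
  nondegenerate X h := by
    ext y hy
    refine g.nondegenerate y _ fun w ↦ ?_
    obtain ⟨W, rfl⟩ := hU y hy w
    have := congrFun (congrArg SmoothFunctionOn.ext (h W)) y
    rw [ext_form, SmoothFunctionOn.ext_apply 0 ⟨y, hy⟩] at this
    exact this
  nabla_smul f X Y := by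
    ext y hy
    rw [SmoothFieldOn.add_apply, SmoothFieldOn.smul_apply, SmoothFieldOn.smul_apply, ext_derivation]
    exact g.leviCivita_smul (f.mdifferentiableAt hy) (Y.mdifferentiableAt hy) _
  D_g X Y Z := by
    ext y hy
    rw [ext_derivation, SmoothFunctionOn.ext_add, ext_form, Pi.add_apply, ext_form, ext_form]
    exact g.isLeviCivita_leviCivita.metric _ (Y.mdifferentiableAt hy) (Z.mdifferentiableAt hy)
  D_bracket X Y f := by
    ext y hy
    have h : X.derivation (Y.derivation f) = X.derivation (Y.derivation f) - Y.derivation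
      (X.derivation f) + Y.derivation (X.derivation f) := by abel
    have h1 := congrFun (congrArg SmoothFunctionOn.ext h) y
    rw [SmoothFunctionOn.ext_add, Pi.add_apply, ← sub_eq_iff_eq_add] at h1
    rw [← h1, ext_derivation, ext_derivation, ext_derivation, ext_derivation, ext_derivation,
      mvfderiv_mlieBracket (f.contMDiffAt hy) (X.smoothFieldAt hy) (Y.smoothFieldAt hy)]
    exact congrArg _ (g.nablaOn_sub_nablaOn X Y hy).symm
  bianchi X Y Z := by
    ext y hy
    have h := g.curvature_cyclic (X.smoothFieldAt hy) (Y.smoothFieldAt hy) (Z.smoothFieldAt hy)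
    rw [← g.curvature_eq_nablaOn X Y Z hy, ← g.curvature_eq_nablaOn Y Z X hy,
      ← g.curvature_eq_nablaOn Z X Y hy] at h
    exact h

end PseudoRiemannianMetric

namespace SmoothFieldOn

/-- The restriction of a smooth field to `U`. -/
def ofSmooth (U : Opens M) (X : Π x : M, TangentSpace I x) (hX : ∀ y ∈ U, SmoothFieldAt X y) :
    SmoothFieldOn I U := by
  classical
  exact ⟨fun y ↦ if y ∈ U then X y else 0, fun y hy ↦ (hX y hy).congr <| by
    filter_upwards [U.isOpen.mem_nhds hy] with z hz
    exact if_pos hz, fun y hy ↦ if_neg hy⟩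

lemma ofSmooth_apply (X : Π x : M, TangentSpace I x) (hX : ∀ y ∈ U, SmoothFieldAt X y) {y : M}
    (hy : y ∈ U) : (ofSmooth U X hX).1 y = X y := if_pos hy

lemma ofSmooth_eventuallyEq (X : Π x : M, TangentSpace I x) (hX : ∀ y ∈ U, SmoothFieldAt X y)
    {y : M} (hy : y ∈ U) : (ofSmooth U X hX).1 =ᶠ[𝓝 y] X := by
  filter_upwards [U.isOpen.mem_nhds hy] with z hz
  exact ofSmooth_apply X hX hz

/-- Every tangent vector at a point of the base set of a trivialization is a value of a smooth field. -/
lemma exists_apply_eq (x : M) {y : M} (hy : y ∈ (trivializationAt E (TangentSpace I) x).baseSet)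
    (v : TangentSpace I y) : ∃ X : SmoothFieldOn I
      ⟨_, (trivializationAt E (TangentSpace I : M → Type _) x).open_baseSet⟩, X.1 y = v := by
  let t := trivializationAt E (TangentSpace I : M → Type _) x
  let b := Module.finBasis ℝ E
  have hs (z : M) (hz : z ∈ t.baseSet) :
      SmoothFieldAt (∑ i, (t.basisAt b hy).repr v i • t.localFrame b i) z := by
    refine Finset.sum_induction _ (fun X ↦ SmoothFieldAt X z) (fun _ _ ↦ .add) .zero fun i _ ↦ ?_
    exact SmoothFieldAt.smul (f := fun _ ↦ (t.basisAt b hy).repr v i) contMDiffAt_const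
      (contMDiffAt_localFrame_of_mem ∞ t b i hz)
  refine ⟨ofSmooth _ _ hs, ?_⟩
  rw [ofSmooth_apply _ hs hy, Finset.sum_apply]
  conv_rhs => rw [← (t.basisAt b hy).sum_repr v]
  exact Finset.sum_congr rfl fun i _ ↦ by
    rw [Pi.smul_apply, t.localFrame_apply_of_mem_baseSet b hy]

end SmoothFieldOn

namespace IsAlmostParacontact

variable {n : ℕ} {φ : Π x : M, TangentSpace I x →L[ℝ] TangentSpace I x}
    {ξ : Π x : M, TangentSpace I x} {η : Π x : M, TangentSpace I x →L[ℝ] ℝ}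
    (hM : IsAlmostParacontact n φ ξ η)

/-- The action of `φ` on the smooth fields on `U`. -/
def phiOn : SmoothFieldOn I U →ₗ[SmoothFunctionOn I U] SmoothFieldOn I U where
  toFun X := ⟨fun y ↦ φ y (X.1 y), fun _ hy ↦ hM.smoothFieldAt_phi (X.smoothFieldAt hy),
    fun _ hy ↦ by simp [X.eq_zero hy]⟩
  map_add' X Y := by ext y hy; exact map_add _ _ _
  map_smul' f X := by ext y hy; exact map_smul _ _ _

/-- The action of `η` on the smooth fields on `U`. -/
def etaOn : SmoothFieldOn I U →ₗ[SmoothFunctionOn I U] SmoothFunctionOn I U where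
  toFun X := restrict (fun y ↦ η y (X.1 y)) (fun y hy ↦ by simp [X.eq_zero hy])
    fun y hy ↦ hM.contMDiffAt_eta (X.smoothFieldAt hy)
  map_add' X Y := by
    ext y hy
    rw [SmoothFunctionOn.ext_add, ext_restrict, Pi.add_apply, ext_restrict, ext_restrict]
    exact map_add _ _ _
  map_smul' f X := by
    ext y hy
    rw [RingHom.id_apply, smul_eq_mul, SmoothFunctionOn.ext_mul, ext_restrict, Pi.mul_apply,
      ext_restrict]
    exact map_smul _ _ _

/-- The field `ξ` on `U`. -/
def xiOn (U : Opens M) : SmoothFieldOn I U := .ofSmooth U ξ fun _ _ ↦ hM.smoothFieldAt_xi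

lemma ext_etaOn (X : SmoothFieldOn I U) : (hM.etaOn X).ext = fun y ↦ η y (X.1 y) :=
  ext_restrict ..

lemma phiOn_apply (X : SmoothFieldOn I U) (y : M) : (hM.phiOn X).1 y = φ y (X.1 y) := rfl

lemma xiOn_apply {y : M} (hy : y ∈ U) : (hM.xiOn U).1 y = ξ y :=
  SmoothFieldOn.ofSmooth_apply _ _ hy

end IsAlmostParacontact

end SmoothFields

/-! ### The (κ, μ)-structure on the model. -/

noncomputable section SmoothFields

variable {E : Type*} [NormedAddCommGroup E] [NormedSpace ℝ E] [FiniteDimensional ℝ E]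
    [CompleteSpace E]
    {H : Type*} [TopologicalSpace H] {I : ModelWithCorners ℝ E H}
    {M : Type*} [TopologicalSpace M] [ChartedSpace H M] [IsManifold I ∞ M]
    {x : M}

open Filter Topology
open TopologicalSpace (Opens)

variable {U : Opens M}

open SmoothFieldOn (ext_derivation)

lemma SmoothFunctionOn.ext_algebraMap (r : ℝ) {y : M} (hy : y ∈ U) :
    (algebraMap ℝ (SmoothFunctionOn I U) r).ext y = r :=
  SmoothFunctionOn.ext_apply (algebraMap ℝ (SmoothFunctionOn I U) r) ⟨y, hy⟩

lemma SmoothFunctionOn.ext_sub (f f' : SmoothFunctionOn I U) : (f - f').ext = f.ext - f'.ext := by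
  rw [eq_sub_iff_add_eq, ← ext_add, sub_add_cancel]

lemma SmoothFunctionOn.ext_neg (f : SmoothFunctionOn I U) : (-f).ext = -f.ext := by
  rw [eq_neg_iff_add_eq_zero, ← ext_add, neg_add_cancel, ← sub_self f, ext_sub, sub_self]

namespace IsParacontactKappaMu

variable {n : ℕ} {φ : Π x : M, TangentSpace I x →L[ℝ] TangentSpace I x}
    {ξ : Π x : M, TangentSpace I x} {η : Π x : M, TangentSpace I x →L[ℝ] ℝ}
    {g : PseudoRiemannianMetric I M} {κ μ : ℝ} (hM : IsParacontactKappaMu n φ ξ η g κ μ)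

/-- The action of `h` on the smooth fields on `U`. -/
def hOn (X : SmoothFieldOn I U) : SmoothFieldOn I U :=
  algebraMap ℝ (SmoothFunctionOn I U) (1 / 2) •
    ((g.nablaOn (hM.xiOn U) (hM.phiOn X) - g.nablaOn (hM.phiOn X) (hM.xiOn U))
      - hM.phiOn (g.nablaOn (hM.xiOn U) X - g.nablaOn X (hM.xiOn U)))

lemma hOn_apply (X : SmoothFieldOn I U) {y : M} (hy : y ∈ U) :
    (hM.hOn X).1 y = paraH φ ξ X.1 y := by
  have h (Y : Π x : M, TangentSpace I x) :
      mlieBracket I (hM.xiOn U).1 Y y = mlieBracket I ξ Y y :=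
    (SmoothFieldOn.ofSmooth_eventuallyEq ξ _ hy).mlieBracket_vectorField_eq .rfl
  rw [hOn, SmoothFieldOn.smul_apply, SmoothFunctionOn.ext_algebraMap _ hy,
    SmoothFieldOn.sub_apply, hM.phiOn_apply, g.nablaOn_sub_nablaOn _ _ hy,
    g.nablaOn_sub_nablaOn _ _ hy, h, h]
  rfl

lemma isKappaMu (hU : ∀ y ∈ U, ∀ v : TangentSpace I y, ∃ X : SmoothFieldOn I U, X.1 y = v) :
    (g.leviCivitaModule hU).IsKappaMu hM.phiOn (hM.xiOn U) hM.etaOn hM.hOn κ μ where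
  eta_xi := by
    ext y hy
    rw [hM.ext_etaOn, SmoothFunctionOn.ext_apply 1 ⟨y, hy⟩]
    exact (congrArg (η y) (hM.xiOn_apply hy)).trans (hM.eta_xi y)
  phi_sq X := by
    ext y hy
    rw [SmoothFieldOn.sub_apply, SmoothFieldOn.smul_apply, hM.xiOn_apply hy, hM.ext_etaOn]
    exact hM.phi_sq y _
  metric_phi X Y := by
    ext y hy
    change (g.form _ _).ext y = (-g.form X Y + hM.etaOn X * hM.etaOn Y).ext y
    rw [SmoothFunctionOn.ext_add, SmoothFunctionOn.ext_neg, SmoothFunctionOn.ext_mul, g.ext_form,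
      g.ext_form, hM.ext_etaOn, hM.ext_etaOn]
    exact hM.metric_phi y _ _
  deriv_eta X Y := by
    ext y hy
    change (X.derivation (hM.etaOn Y) - Y.derivation (hM.etaOn X)
      - hM.etaOn (g.nablaOn X Y - g.nablaOn Y X)).ext y = (2 * g.form X (hM.phiOn Y)).ext y
    have h := hM.deriv_eta _ _ y (X.smoothFieldAt hy) (Y.smoothFieldAt hy)
    rw [two_mul, SmoothFunctionOn.ext_sub, SmoothFunctionOn.ext_sub, SmoothFunctionOn.ext_add,
      ext_derivation, ext_derivation, hM.ext_etaOn, hM.ext_etaOn, hM.ext_etaOn, g.ext_form]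
    simp only [Pi.sub_apply, Pi.add_apply, g.nablaOn_sub_nablaOn _ _ hy, hM.phiOn_apply, ← h,
      oneFormDeriv]
    ring
  two_h X := by
    have h : (2 : SmoothFunctionOn I U) * algebraMap ℝ _ (1 / 2) = 1 := by
      rw [mul_comm]; exact LeviCivitaModule.half_mul_two
    change _ • hM.hOn X = (_ : SmoothFieldOn I U)
    rw [hOn, smul_smul, h, one_smul]
    rfl
  nullity X Y := by
    ext y hy
    -- The field `xiOn` agrees with ξ only on U; at points of U the curvature does not see the
    -- difference.
    have h1 := g.curvature_congr (X.smoothFieldAt hy) (Y.smoothFieldAt hy)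
      (hM.smoothFieldAt_xi (x := y)) (X.smoothFieldAt hy) (Y.smoothFieldAt hy)
      ((hM.xiOn U).smoothFieldAt hy) rfl rfl (hM.xiOn_apply hy)
    refine (g.curvature_eq_nablaOn X Y (hM.xiOn U) hy).trans (h1.trans
      ((hM.nullity _ _ y (X.smoothFieldAt hy) (Y.smoothFieldAt hy)).trans ?_))
    simp only [SmoothFieldOn.add_apply, SmoothFieldOn.smul_apply, SmoothFieldOn.sub_apply,
      SmoothFunctionOn.ext_algebraMap _ hy, hM.hOn_apply _ hy, hM.ext_etaOn]

end IsParacontactKappaMu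

end SmoothFields

/-! ### Evaluation at a point and restriction to eigenvectors. -/

noncomputable section SmoothFields

variable {E : Type*} [NormedAddCommGroup E] [NormedSpace ℝ E] [FiniteDimensional ℝ E]
    [CompleteSpace E]
    {H : Type*} [TopologicalSpace H] {I : ModelWithCorners ℝ E H}
    {M : Type*} [TopologicalSpace M] [ChartedSpace H M] [IsManifold I ∞ M]
    {x : M}

open Filter Topology
open TopologicalSpace (Opens)

variable {U : Opens M}

/-- The evaluation of smooth functions at a point. -/
def SmoothFunctionOn.eval (y : U) : SmoothFunctionOn I U →ₐ[ℝ] ℝ :=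
  (Pi.evalAlgHom ℝ _ y).comp (smoothFunctionsOn I U).val

lemma LeviCivitaModule.IsKappaMu.phi_h {C V : Type*} [CommRing C] [Algebra ℝ C] [AddCommGroup V]
    [Module C V] {L : LeviCivitaModule C V} {φ : V →ₗ[C] V} {ξ : V} {η : V →ₗ[C] C} {h : V → V}
    {κ μ : ℝ} (H : L.IsKappaMu φ ξ η h κ μ) (X : V) : φ (h X) = L.phiH φ ξ X := by
  rw [H.h_eq, H.phi_sq, H.eta_phiH, zero_smul, sub_zero]

namespace IsParacontactKappaMu

variable {n : ℕ} {φ : Π x : M, TangentSpace I x →L[ℝ] TangentSpace I x}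
    {ξ : Π x : M, TangentSpace I x} {η : Π x : M, TangentSpace I x →L[ℝ] ℝ}
    {g : PseudoRiemannianMetric I M} {κ μ : ℝ} (hM : IsParacontactKappaMu n φ ξ η g κ μ)
    {X Y Z W : Π x : M, TangentSpace I x}

include hM

/-- Near every point there is a structure of the algebraic model whose fields realize all tangent
vectors. -/
lemma exists_model (x : M) : ∃ (U : Opens M) (_ : x ∈ U)
    (hU : ∀ y ∈ U, ∀ v : TangentSpace I y, ∃ X : SmoothFieldOn I U, X.1 y = v),
    (g.leviCivitaModule hU).IsKappaMu hM.phiOn (hM.xiOn U) hM.etaOn hM.hOn κ μ :=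
  ⟨⟨_, (trivializationAt E (TangentSpace I : M → Type _) x).open_baseSet⟩,
    FiberBundle.mem_baseSet_trivializationAt E _ x,
    fun _ hy v ↦ SmoothFieldOn.exists_apply_eq x hy v, hM.isKappaMu _⟩

lemma paraH_symm (hX : SmoothFieldAt X x) (hY : SmoothFieldAt Y x) :
    g.val x (paraH φ ξ X x) (Y x) = g.val x (X x) (paraH φ ξ Y x) := by
  obtain ⟨U, hx, hU, H⟩ := hM.exists_model x
  obtain ⟨X', hX'⟩ := hU x hx (X x)
  obtain ⟨Y', hY'⟩ := hU x hx (Y x)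
  have h : (g.leviCivitaModule hU).g (hM.hOn X') Y' = (g.leviCivitaModule hU).g X' (hM.hOn Y') := by
    rw [H.h_eq, H.h_eq, H.g_phi_left, H.phiH_symm, H.phiH_phi, map_neg, neg_neg]
  have h1 : g.val x ((hM.hOn X').1 x) (Y'.1 x) = g.val x (X'.1 x) ((hM.hOn Y').1 x) :=
    congrArg (SmoothFunctionOn.eval ⟨x, hx⟩) h
  rwa [hM.hOn_apply _ hx, hM.hOn_apply _ hx, hX', hY',
    hM.paraH_congr (X'.smoothFieldAt hx) hX hX', hM.paraH_congr (Y'.smoothFieldAt hx) hY hY'] at h1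

lemma phi_paraH_symm (hX : SmoothFieldAt X x) (hY : SmoothFieldAt Y x) :
    g.val x (φ x (paraH φ ξ X x)) (Y x) = g.val x (X x) (φ x (paraH φ ξ Y x)) := by
  obtain ⟨U, hx, hU, H⟩ := hM.exists_model x
  obtain ⟨X', hX'⟩ := hU x hx (X x)
  obtain ⟨Y', hY'⟩ := hU x hx (Y x)
  have h : (g.leviCivitaModule hU).g (hM.phiOn (hM.hOn X')) Y' =
      (g.leviCivitaModule hU).g X' (hM.phiOn (hM.hOn Y')) := by
    rw [H.phi_h, H.phi_h, H.phiH_symm]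
  have h1 : g.val x (φ x ((hM.hOn X').1 x)) (Y'.1 x) = g.val x (X'.1 x) (φ x ((hM.hOn Y').1 x)) :=
    congrArg (SmoothFunctionOn.eval ⟨x, hx⟩) h
  rwa [hM.hOn_apply _ hx, hM.hOn_apply _ hx, hX', hY',
    hM.paraH_congr (X'.smoothFieldAt hx) hX hX', hM.paraH_congr (Y'.smoothFieldAt hx) hY hY'] at h1

lemma eta_paraH (hX : SmoothFieldAt X x) : η x (paraH φ ξ X x) = 0 := by
  obtain ⟨U, hx, hU, H⟩ := hM.exists_model x
  obtain ⟨X', hX'⟩ := hU x hx (X x)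
  have h : hM.etaOn (hM.hOn X') = 0 := by rw [H.h_eq, H.eta_phi]
  have h1 : η x ((hM.hOn X').1 x) = 0 := congrArg (SmoothFunctionOn.eval ⟨x, hx⟩) h
  rwa [hM.hOn_apply _ hx, hM.paraH_congr (X'.smoothFieldAt hx) hX hX'] at h1

lemma val_phi_left (v w : TangentSpace I x) : g.val x (φ x v) w = - g.val x v (φ x w) := by
  obtain ⟨U, hx, hU, H⟩ := hM.exists_model x
  obtain ⟨X, rfl⟩ := hU x hx v
  obtain ⟨Y, rfl⟩ := hU x hx w
  exact congrArg (SmoothFunctionOn.eval ⟨x, hx⟩) (H.g_phi_left X Y)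

lemma eta_phi (v : TangentSpace I x) : η x (φ x v) = 0 := by
  obtain ⟨U, hx, hU, H⟩ := hM.exists_model x
  obtain ⟨X, rfl⟩ := hU x hx v
  exact congrArg (SmoothFunctionOn.eval ⟨x, hx⟩) (H.eta_phi X)

/-- The curvature of a paracontact metric `(κ, μ)`-manifold with `κ < -1`. -/
theorem val_curvature (hκ : κ < -1) (hX : SmoothFieldAt X x) (hY : SmoothFieldAt Y x)
    (hZ : SmoothFieldAt Z x) :
    g.val x (g.curvature X Y Z x) (W x) =
      (-1 + μ / 2) * (g.val x (Y x) (Z x) * g.val x (X x) (W x)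
          - g.val x (X x) (Z x) * g.val x (Y x) (W x))
      + g.val x (Y x) (Z x) * g.val x (paraH φ ξ X x) (W x)
      - g.val x (X x) (Z x) * g.val x (paraH φ ξ Y x) (W x)
      - g.val x (Y x) (W x) * g.val x (paraH φ ξ X x) (Z x)
      + g.val x (X x) (W x) * g.val x (paraH φ ξ Y x) (Z x)
      + (-1 + μ / 2) / (κ + 1) * (g.val x (paraH φ ξ Y x) (Z x) * g.val x (paraH φ ξ X x) (W x)
          - g.val x (paraH φ ξ X x) (Z x) * g.val x (paraH φ ξ Y x) (W x))
      - μ / 2 * (g.val x (φ x (Y x)) (Z x) * g.val x (φ x (X x)) (W x)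
          - g.val x (φ x (X x)) (Z x) * g.val x (φ x (Y x)) (W x))
      + (-κ - μ / 2) / (κ + 1) *
        (g.val x (φ x (paraH φ ξ Y x)) (Z x) * g.val x (φ x (paraH φ ξ X x)) (W x)
          - g.val x (φ x (paraH φ ξ Y x)) (W x) * g.val x (φ x (paraH φ ξ X x)) (Z x))
      + μ * g.val x (φ x (X x)) (Y x) * g.val x (φ x (Z x)) (W x)
      + η x (X x) * η x (W x) * ((κ + 1 - μ / 2) * g.val x (Y x) (Z x)
          + (μ - 1) * g.val x (paraH φ ξ Y x) (Z x))
      - η x (X x) * η x (Z x) * ((κ + 1 - μ / 2) * g.val x (Y x) (W x)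
          + (μ - 1) * g.val x (paraH φ ξ Y x) (W x))
      + η x (Y x) * η x (Z x) * ((κ + 1 - μ / 2) * g.val x (X x) (W x)
          + (μ - 1) * g.val x (paraH φ ξ X x) (W x))
      - η x (Y x) * η x (W x) * ((κ + 1 - μ / 2) * g.val x (X x) (Z x)
          + (μ - 1) * g.val x (paraH φ ξ X x) (Z x)) := by
  obtain ⟨U, hx, hU, H⟩ := hM.exists_model x
  obtain ⟨X', hX'⟩ := hU x hx (X x)
  obtain ⟨Y', hY'⟩ := hU x hx (Y x)
  obtain ⟨Z', hZ'⟩ := hU x hx (Z x)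
  obtain ⟨W', hW'⟩ := hU x hx (W x)
  have hl : √(-1 - κ) ≠ 0 := (Real.sqrt_pos.2 (by linarith)).ne'
  have hκ' : κ + 1 ≠ 0 := by linarith
  let a := algebraMap ℝ (SmoothFunctionOn I U)
  -- All scalars are real constants embedded in the functions on U; κ < -1 makes √(-1-κ) and κ + 1
  -- invertible.
  have h := H.g_R_eq (l := a √(-1 - κ)) (i := a (√(-1 - κ))⁻¹) (k := a κ) (b := a (μ / 2))
    (c := a ((-1 + μ / 2) / (κ + 1))) (by rw [← map_mul, inv_mul_cancel₀ hl, map_one])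
    (by
      rw [← map_mul, Real.mul_self_sqrt (by linarith), ← map_one a, ← map_add, ← map_neg]
      congr 1; ring) rfl
    (by rw [two_mul, ← map_add, add_halves])
    (by
      rw [← map_one a, ← map_add, ← map_mul, ← map_add]
      congr 1; field_simp; ring) X' Y' Z' W'
  simp only [LeviCivitaModule.kappaMuForm, ← H.h_eq] at h
  simp only [← H.phi_h] at h
  have e := congrArg (SmoothFunctionOn.eval (I := I) ⟨x, hx⟩) h
  simp only [map_add, map_sub, map_mul, map_neg, map_one, map_ofNat, a, AlgHom.commutes] at e
  have eg (A B : SmoothFieldOn I U) : SmoothFunctionOn.eval ⟨x, hx⟩ ((g.leviCivitaModule hU).g A B) =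
    g.val x (A.1 x) (B.1 x) := rfl
  have eη (A : SmoothFieldOn I U) : SmoothFunctionOn.eval ⟨x, hx⟩ (hM.etaOn A) =
    η x (A.1 x) := rfl
  have eR : ((g.leviCivitaModule hU).R X' Y' Z').1 x = g.curvature X'.1 Y'.1 Z'.1 x :=
    g.curvature_eq_nablaOn X' Y' Z' hx
  simp only [eg, eη, eR, hM.phiOn_apply, hM.hOn_apply _ hx, hX', hY', hZ', hW',
    hM.paraH_congr (X'.smoothFieldAt hx) hX hX', hM.paraH_congr (Y'.smoothFieldAt hx) hY hY',
    g.curvature_congr hX hY hZ (X'.smoothFieldAt hx) (Y'.smoothFieldAt hx) (Z'.smoothFieldAt hx)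
      hX' hY' hZ', Algebra.algebraMap_self, RingHom.id_apply] at e
  -- The model uses the coefficient -1 - c, which is the stated quotient.
  have hc : (-κ - μ / 2) / (κ + 1) = -1 - (-1 + μ / 2) / (κ + 1) := by
    field_simp; ring
  rw [e, hc]
  ring

variable {s : ℝ}

/-- Apply φ to φhX = sX: since η(hX) = 0, φ² fixes hX. Applying η instead gives s η(X) = 0. -/
lemma paraH_eq_of_eig (hs : s ≠ 0) (hX : SmoothFieldAt X x)
    (h : φ x (paraH φ ξ X x) = s • X x) :
    paraH φ ξ X x = s • φ x (X x) ∧ η x (X x) = 0 := by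
  constructor
  · rw [← map_smul, ← h, hM.phi_sq, hM.eta_paraH hX, zero_smul, sub_zero]
  · have h1 := hM.eta_phi (paraH φ ξ X x)
    rw [h, map_smul] at h1
    exact (smul_eq_zero.1 h1).resolve_left hs

lemma val_eq_zero_of_eig (hs : s ≠ 0) (hX : SmoothFieldAt X x) (hY : SmoothFieldAt Y x)
    (h : φ x (paraH φ ξ X x) = s • X x) (h' : φ x (paraH φ ξ Y x) = (-s) • Y x) :
    g.val x (X x) (Y x) = 0 := by
  have h1 := hM.phi_paraH_symm hX hY
  rw [h, h', map_smul, map_smul, smul_apply, smul_eq_mul, smul_eq_mul] at h1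
  have h2 : s * g.val x (X x) (Y x) = 0 := by linear_combination h1 / 2
  exact (mul_eq_zero.1 h2).resolve_left hs

/-- Here h is symmetric and acts as sφ on both vectors, while φ is skew. -/
lemma val_phi_eq_zero_of_eig (hs : s ≠ 0) (hX : SmoothFieldAt X x) (hY : SmoothFieldAt Y x)
    (h : φ x (paraH φ ξ X x) = s • X x) (h' : φ x (paraH φ ξ Y x) = s • Y x) :
    g.val x (X x) (φ x (Y x)) = 0 := by
  have h1 := hM.paraH_symm hX hY
  rw [(hM.paraH_eq_of_eig hs hX h).1, (hM.paraH_eq_of_eig hs hY h').1, map_smul, map_smul,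
    smul_apply, smul_eq_mul, smul_eq_mul, hM.val_phi_left] at h1
  have h2 : s * g.val x (X x) (φ x (Y x)) = 0 := by linear_combination -h1 / 2
  exact (mul_eq_zero.1 h2).resolve_left hs

lemma val_phi_swap (v w : TangentSpace I x) : g.val x v (φ x w) = - g.val x w (φ x v) := by
  rw [g.symm, hM.val_phi_left]

variable {X' X'' : Π x : M, TangentSpace I x}

/-- The general formula on eigenvectors. Only s² = -1-κ is required, so this lemma and the next two
serve both signs of the eigenvalue. -/
lemma curvature_eig_eig_eig (hκ : κ < -1) (hs : s ^ 2 = -1 - κ) (hX : SmoothFieldAt X x)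
    (hX' : SmoothFieldAt X' x) (hX'' : SmoothFieldAt X'' x)
    (h : φ x (paraH φ ξ X x) = s • X x) (h' : φ x (paraH φ ξ X' x) = s • X' x)
    (h'' : φ x (paraH φ ξ X'' x) = s • X'' x) :
    g.curvature X X' X'' x =
      (κ - 1 + μ) • (g.val x (X' x) (X'' x) • X x - g.val x (X x) (X'' x) • X' x)
      + s • (g.val x (X' x) (X'' x) • φ x (X x) - g.val x (X x) (X'' x) • φ x (X' x)) := by
  have hs0 : s ≠ 0 := by rintro rfl; linarith
  obtain ⟨e, o⟩ := hM.paraH_eq_of_eig hs0 hX h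
  obtain ⟨e', o'⟩ := hM.paraH_eq_of_eig hs0 hX' h'
  refine g.eq_of_val_eq_smooth fun W _ ↦ ?_
  rw [hM.val_curvature hκ hX hX' hX'', h, h', e, e', o, o']
  -- Eliminating κ turns the denominator κ + 1 into -s².
  obtain rfl : κ = -1 - s ^ 2 := by linarith
  have hd : -1 - s ^ 2 + 1 = -s ^ 2 := by ring
  simp only [map_add, map_sub, map_smul, add_apply, sub_apply, smul_apply, smul_eq_mul,
    hd, hM.val_phi_left, hM.val_phi_eq_zero_of_eig hs0 hX hX' h h',
    hM.val_phi_eq_zero_of_eig hs0 hX hX'' h h'', hM.val_phi_eq_zero_of_eig hs0 hX' hX'' h' h'']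
  field_simp
  ring

lemma curvature_eig_eig_neg (hκ : κ < -1) (hs : s ^ 2 = -1 - κ) (hX : SmoothFieldAt X x)
    (hX' : SmoothFieldAt X' x) (hY : SmoothFieldAt Y x)
    (h : φ x (paraH φ ξ X x) = s • X x) (h' : φ x (paraH φ ξ X' x) = s • X' x)
    (h'' : φ x (paraH φ ξ Y x) = (-s) • Y x) :
    g.curvature X X' Y x =
      -(s • (g.val x (X' x) (φ x (Y x)) • X x - g.val x (X x) (φ x (Y x)) • X' x))
      - (1 - μ) • (g.val x (X' x) (φ x (Y x)) • φ x (X x)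
        - g.val x (X x) (φ x (Y x)) • φ x (X' x)) := by
  have hs0 : s ≠ 0 := by rintro rfl; linarith
  obtain ⟨e, o⟩ := hM.paraH_eq_of_eig hs0 hX h
  obtain ⟨e', o'⟩ := hM.paraH_eq_of_eig hs0 hX' h'
  refine g.eq_of_val_eq_smooth fun W _ ↦ ?_
  rw [hM.val_curvature hκ hX hX' hY, h, h', e, e', o, o']
  obtain rfl : κ = -1 - s ^ 2 := by linarith
  have hd : -1 - s ^ 2 + 1 = -s ^ 2 := by ring
  simp only [map_sub, map_neg, map_smul, sub_apply, neg_apply, smul_apply, smul_eq_mul, hd,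
    hM.val_phi_left, hM.val_phi_eq_zero_of_eig hs0 hX hX' h h',
    hM.val_eq_zero_of_eig hs0 hX hY h h'', hM.val_eq_zero_of_eig hs0 hX' hY h' h'']
  field_simp
  ring

lemma curvature_eig_neg_eig (hκ : κ < -1) (hs : s ^ 2 = -1 - κ) (hX : SmoothFieldAt X x)
    (hY : SmoothFieldAt Y x) (hX' : SmoothFieldAt X' x)
    (h : φ x (paraH φ ξ X x) = s • X x) (h'' : φ x (paraH φ ξ Y x) = (-s) • Y x)
    (h' : φ x (paraH φ ξ X' x) = s • X' x) :
    g.curvature X Y X' x =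
      -((s * g.val x (X' x) (φ x (Y x))) • X x) - g.val x (X' x) (φ x (Y x)) • φ x (X x)
      - (s ^ 2 * g.val x (X x) (X' x)) • Y x + (s * g.val x (X x) (X' x)) • φ x (Y x)
      - (μ * g.val x (X x) (φ x (Y x))) • φ x (X' x) := by
  have hs0 : s ≠ 0 := by rintro rfl; linarith
  obtain ⟨e, o⟩ := hM.paraH_eq_of_eig hs0 hX h
  obtain ⟨e', o'⟩ := hM.paraH_eq_of_eig (neg_ne_zero.2 hs0) hY h''
  refine g.eq_of_val_eq_smooth fun W _ ↦ ?_
  rw [hM.val_curvature hκ hX hY hX', h, h'', e, e', o, o']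
  obtain rfl : κ = -1 - s ^ 2 := by linarith
  have hd : -1 - s ^ 2 + 1 = -s ^ 2 := by ring
  have h0 : g.val x (Y x) (X' x) = 0 := by
    rw [g.symm, hM.val_eq_zero_of_eig hs0 hX' hY h' h'']
  simp only [map_add, map_sub, map_neg, map_smul, add_apply, sub_apply, neg_apply, smul_apply,
    smul_eq_mul, hd, hM.val_phi_left, hM.val_phi_eq_zero_of_eig hs0 hX hX' h h', h0,
    hM.val_phi_swap (Y x) (X' x)]
  field_simp
  ring

end IsParacontactKappaMu

end SmoothFields

theorem corollary5p9 (n : ℕ)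
    {M : Type*} [TopologicalSpace M] [ChartedSpace (EuclideanSpace ℝ (Fin (2 * n + 1))) M]
    [IsManifold (𝓡 (2 * n + 1)) ∞ M]
    (φ : Π x : M, TangentSpace (𝓡 (2 * n + 1)) x →L[ℝ] TangentSpace (𝓡 (2 * n + 1)) x)
    (ξ : Π x : M, TangentSpace (𝓡 (2 * n + 1)) x)
    (η : Π x : M, TangentSpace (𝓡 (2 * n + 1)) x →L[ℝ] ℝ)
    (g : PseudoRiemannianMetric (𝓡 (2 * n + 1)) M)
    (κ μ : ℝ) (hM : IsParacontactKappaMu n φ ξ η g κ μ) (hκ : κ < -1) :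
    -- the relations on the eigendistributions of `φ h` for the eigenvalues `lam` and `-lam`
    (∀ lam : ℝ, lam = √(-1 - κ) →
      ∀ (x : M) (X X' X'' Y Y' Y'' : Π x : M, TangentSpace (𝓡 (2 * n + 1)) x),
      SmoothFieldAt X x → SmoothFieldAt X' x → SmoothFieldAt X'' x →
      SmoothFieldAt Y x → SmoothFieldAt Y' x → SmoothFieldAt Y'' x →
      φ x (paraH φ ξ X x) = lam • X x →
      φ x (paraH φ ξ X' x) = lam • X' x →
      φ x (paraH φ ξ X'' x) = lam • X'' x →
      φ x (paraH φ ξ Y x) = (-lam) • Y x →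
      φ x (paraH φ ξ Y' x) = (-lam) • Y' x →
      φ x (paraH φ ξ Y'' x) = (-lam) • Y'' x →
      g.curvature X X' X'' x =
          (κ - 1 + μ) • (g.val x (X' x) (X'' x) • X x - g.val x (X x) (X'' x) • X' x)
          + lam • (g.val x (X' x) (X'' x) • φ x (X x) - g.val x (X x) (X'' x) • φ x (X' x)) ∧
      g.curvature X X' Y x =
          -(lam • (g.val x (X' x) (φ x (Y x)) • X x - g.val x (X x) (φ x (Y x)) • X' x))
          - (1 - μ) • (g.val x (X' x) (φ x (Y x)) • φ x (X x)
            - g.val x (X x) (φ x (Y x)) • φ x (X' x)) ∧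
      g.curvature X Y X' x =
          -((lam * g.val x (X' x) (φ x (Y x))) • X x)
          - g.val x (X' x) (φ x (Y x)) • φ x (X x)
          - (lam ^ 2 * g.val x (X x) (X' x)) • Y x
          + (lam * g.val x (X x) (X' x)) • φ x (Y x)
          - (μ * g.val x (X x) (φ x (Y x))) • φ x (X' x) ∧
      g.curvature X Y Y' x =
          (lam ^ 2 * g.val x (Y x) (Y' x)) • X x
          + (lam * g.val x (Y x) (Y' x)) • φ x (X x)
          + (lam * g.val x (X x) (φ x (Y' x))) • Y x
          - g.val x (X x) (φ x (Y' x)) • φ x (Y x)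
          - (μ * g.val x (X x) (φ x (Y x))) • φ x (Y' x) ∧
      g.curvature Y Y' X x =
          -(lam • (g.val x (X x) (φ x (Y' x)) • Y x - g.val x (X x) (φ x (Y x)) • Y' x))
          + (1 - μ) • (g.val x (X x) (φ x (Y' x)) • φ x (Y x)
            - g.val x (X x) (φ x (Y x)) • φ x (Y' x)) ∧
      g.curvature Y Y' Y'' x =
          (κ - 1 + μ) • (g.val x (Y' x) (Y'' x) • Y x - g.val x (Y x) (Y'' x) • Y' x)
          - lam • (g.val x (Y' x) (Y'' x) • φ x (Y x) - g.val x (Y x) (Y'' x) • φ x (Y' x))) ∧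
    -- the formula for the whole curvature tensor
    (∀ (x : M) (X Y Z W : Π x : M, TangentSpace (𝓡 (2 * n + 1)) x),
      SmoothFieldAt X x → SmoothFieldAt Y x → SmoothFieldAt Z x → SmoothFieldAt W x →
      g.val x (g.curvature X Y Z x) (W x) =
        (-1 + μ / 2) * (g.val x (Y x) (Z x) * g.val x (X x) (W x)
            - g.val x (X x) (Z x) * g.val x (Y x) (W x))
        + g.val x (Y x) (Z x) * g.val x (paraH φ ξ X x) (W x)
        - g.val x (X x) (Z x) * g.val x (paraH φ ξ Y x) (W x)
        - g.val x (Y x) (W x) * g.val x (paraH φ ξ X x) (Z x)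
        + g.val x (X x) (W x) * g.val x (paraH φ ξ Y x) (Z x)
        + (-1 + μ / 2) / (κ + 1) * (g.val x (paraH φ ξ Y x) (Z x) * g.val x (paraH φ ξ X x) (W x)
            - g.val x (paraH φ ξ X x) (Z x) * g.val x (paraH φ ξ Y x) (W x))
        - μ / 2 * (g.val x (φ x (Y x)) (Z x) * g.val x (φ x (X x)) (W x)
            - g.val x (φ x (X x)) (Z x) * g.val x (φ x (Y x)) (W x))
        + (-κ - μ / 2) / (κ + 1) * (g.val x (φ x (paraH φ ξ Y x)) (Z x) * g.val x (φ x (paraH φ ξ X x)) (W x)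
            - g.val x (φ x (paraH φ ξ Y x)) (W x) * g.val x (φ x (paraH φ ξ X x)) (Z x))
        + μ * g.val x (φ x (X x)) (Y x) * g.val x (φ x (Z x)) (W x)
        + η x (X x) * η x (W x) * ((κ + 1 - μ / 2) * g.val x (Y x) (Z x)
            + (μ - 1) * g.val x (paraH φ ξ Y x) (Z x))
        - η x (X x) * η x (Z x) * ((κ + 1 - μ / 2) * g.val x (Y x) (W x)
            + (μ - 1) * g.val x (paraH φ ξ Y x) (W x))
        + η x (Y x) * η x (Z x) * ((κ + 1 - μ / 2) * g.val x (X x) (W x)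
            + (μ - 1) * g.val x (paraH φ ξ X x) (W x))
        - η x (Y x) * η x (W x) * ((κ + 1 - μ / 2) * g.val x (X x) (Z x)
            + (μ - 1) * g.val x (paraH φ ξ X x) (Z x))) := by
  refine ⟨?_, fun x X Y Z W hX hY hZ _ ↦ hM.val_curvature hκ hX hY hZ⟩
  rintro s rfl x X X' X'' Y Y' Y'' hX hX' hX'' hY hY' hY'' eX eX' eX'' eY eY' eY''
  have hs : √(-1 - κ) ^ 2 = -1 - κ := Real.sq_sqrt (by linarith)
  -- From here on the sign of the root is irrelevant, so the last three relations are the first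
  -- three with s replaced by -s and the two eigenspaces exchanged.
  generalize √(-1 - κ) = s at hs eX eX' eX'' eY eY' eY'' ⊢
  have hs' : (-s) ^ 2 = -1 - κ := by rw [neg_sq, hs]
  have neg {Z : Π x : M, TangentSpace (𝓡 (2 * n + 1)) x}
      (h : φ x (paraH φ ξ Z x) = s • Z x) : φ x (paraH φ ξ Z x) = (- -s) • Z x := by rw [h, neg_neg]
  refine ⟨hM.curvature_eig_eig_eig hκ hs hX hX' hX'' eX eX' eX'',
    hM.curvature_eig_eig_neg hκ hs hX hX' hY eX eX' eY,
    hM.curvature_eig_neg_eig hκ hs hX hY hX' eX eY eX', ?_, ?_, ?_⟩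
  -- The mixed relation is also turned around by R_{XY} = -R_{YX}.
  · rw [g.curvature_swap, hM.curvature_eig_neg_eig hκ hs' hY hX hY' eY (neg eX) eY',
      hM.val_phi_swap (Y' x) (X x), hM.val_phi_swap (Y x) (X x)]
    module
  · rw [hM.curvature_eig_eig_neg hκ hs' hY hY' hX eY eY' (neg eX),
      hM.val_phi_swap (Y' x) (X x), hM.val_phi_swap (Y x) (X x)]
    module
  · rw [hM.curvature_eig_eig_eig hκ hs' hY hY' hY'' eY eY' eY'']
    module
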